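/- All graphs are finite and simple. Let $G$ be a connected $K_4$-minor-free graph. Then the following four statements are equivalent. 1. $G$ is $1$-perfectly orientable, that is, $G$ has an orientation in which the out-neighborhood of every vertex is a clique of $G$. 2. None of the graphs $K_{2,3}$, $F_1$, $F_2$ is an induced minor of $G$. 3. Every block of $G$ is a $2$-tree, except possibly one, which is either $K_1$ or a hollowed $2$-tree. 4. $G$ can be constructed from either $K_1$ or a cycle by a finite (possibly empty) sequence of operations, each of which is one of $(A_1)$: attach a simplicial vertex of degree $1$ (add a new vertex adjacent to exactly one vertex); $(A_2)$: attach a simplicial vertex of degree $2$ (add a new vertex adjacent to exactly two vertices, which are adjacent to each other). Here the following definitions are used. A graph $H$ is a minor of $G$ if there are pairwise disjoint sets $S_a\subseteq V(G)$, $a\in V(H)$, each inducing a (nonempty) connected subgraph of $G$, such that for every two adjacent vertices $a,b$ of $H$ some edge of $G$ joins $S_a$ to $S_b$; $H$ is an induced minor of $G$ if the $S_a$ can be chosen such that, for every two distinct $a,b\in V(H)$, an edge of $G$ joins $S_a$ to $S_b$ if and only if $a$ and $b$ are adjacent in $H$. The graph $G$ is $K_4$-minor-free if $K_4$ is not a minor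 of $G$. The graph $F_1$ (the domino) consists of two $4$-cycles sharing exactly one edge and its two endpoints ($6$ vertices, $7$ edges), and $F_2$ consists of two $4$-cycles sharing exactly one vertex ($7$ vertices, $8$ edges). A block of $G$ is a maximal biconnected subgraph, where a graph is biconnected if it is connected and has no vertex whose deletion leaves a disconnected graph (so $K_1$ and $K_2$ are biconnected). A vertex is simplicial if its neighborhood is a clique. The class of $2$-trees is the smallest class (closed under isomorphism) that contains $K_2$ and every graph obtained from one of its members by adding a simplicial vertex of degree $2$; the class of hollowed $2$-trees is defined in the same way, starting from all cycles of length at least $4$ instead of $K_2$. -/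

import Mathlib

universe u v w

namespace SimpleGraph

/-! ### Orientations -/

/-- `D` is an orientation of `G`: every edge of `G` receives exactly one of its two directions, and
`D` has no other arcs. -/
def IsOrientation {V : Type u} (G : SimpleGraph V) (D : Digraph V) : Prop :=
  (∀ x y, G.Adj x y ↔ D.Adj x y ∨ D.Adj y x) ∧ ∀ x y, D.Adj x y → ¬ D.Adj y x

/-- `G` is 1-perfectly orientable: it has an orientation in which the out-neighborhood of every
vertex is a clique of `G`. -/
def IsOnePerfectlyOrientable {V : Type u} (G : SimpleGraph V) : Prop :=
  ∃ D : Digraph V, G.IsOrientation D ∧ ∀ x, G.IsClique {y | D.Adj x y}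

/-! ### Minors and induced minors -/

/-- `H` is a minor of `G`: there is a minor model of `H` in `G`, i.e. a family of pairwise disjoint
vertex sets of `G`, each inducing a connected (in particular nonempty) subgraph, such that there is
an edge of `G` between the sets of any two adjacent vertices of `H`. -/
def IsMinor {W : Type v} {V : Type u} (H : SimpleGraph W) (G : SimpleGraph V) : Prop :=
  ∃ S : W → Set V,
    (Pairwise fun a b => Disjoint (S a) (S b)) ∧
    (∀ a, (G.induce (S a)).Connected) ∧
    ∀ a b, H.Adj a b → ∃ x ∈ S a, ∃ y ∈ S b, G.Adj x y

/-- `H` is an induced minor of `G`: there is an induced minor model of `H` in `G`, i.e. a family of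
pairwise disjoint vertex sets of `G`, each inducing a connected (in particular nonempty) subgraph,
such that two distinct vertices of `H` are adjacent if and only if there is an edge of `G` between
their sets. -/
def IsInducedMinor {W : Type v} {V : Type u} (H : SimpleGraph W) (G : SimpleGraph V) : Prop :=
  ∃ S : W → Set V,
    (Pairwise fun a b => Disjoint (S a) (S b)) ∧
    (∀ a, (G.induce (S a)).Connected) ∧
    ∀ a b, a ≠ b → (H.Adj a b ↔ ∃ x ∈ S a, ∃ y ∈ S b, G.Adj x y)

/-- The graph `F₁` (the domino): two 4-cycles `0 1 2 3` and `0 1 4 5` sharing the edge `0 1`. -/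
def graphF1 : SimpleGraph (Fin 6) :=
  fromEdgeSet {s(0, 1), s(1, 2), s(2, 3), s(3, 0), s(1, 4), s(4, 5), s(5, 0)}

/-- The graph `F₂`: two 4-cycles `0 1 2 3` and `0 4 5 6` sharing exactly the vertex `0`. -/
def graphF2 : SimpleGraph (Fin 7) :=
  fromEdgeSet {s(0, 1), s(1, 2), s(2, 3), s(3, 0), s(0, 4), s(4, 5), s(5, 6), s(6, 0)}

/-! ### Blocks -/

/-- `v` is a cut vertex of `G`: the graph `G - v` is disconnected, i.e. it has two vertices that no
walk joins. The graph without vertices does not count as disconnected, so that the vertex of `K₁`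
is not a cut vertex. -/
def IsCutVertex {V : Type u} (G : SimpleGraph V) (v : V) : Prop :=
  ¬ (G.induce {v}ᶜ).Preconnected

/-- `G` is biconnected: connected and without cut vertices. (`K₁` and `K₂` are biconnected.) -/
def IsBiconnected {V : Type u} (G : SimpleGraph V) : Prop :=
  G.Connected ∧ ∀ v, ¬ G.IsCutVertex v

/-- A block of `G` is a maximal biconnected subgraph of `G`. -/
def IsBlock {V : Type u} (G : SimpleGraph V) (B : G.Subgraph) : Prop :=
  Maximal (fun H : G.Subgraph => H.coe.IsBiconnected) B

/-! ### Adding simplicial vertices, 2-trees and hollowed 2-trees -/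

/-- A vertex is simplicial if its neighborhood is a clique. -/
def IsSimplicial {V : Type u} (G : SimpleGraph V) (v : V) : Prop :=
  G.IsClique (G.neighborSet v)

/-- `G` is obtained, up to isomorphism, from `H` by adding one new vertex, which is simplicial of
degree `d` in `G`. (Used for `d = 1` and `d = 2` only.) -/
def IsSimplicialExtension {W : Type v} {V : Type u} (d : ℕ) (H : SimpleGraph W)
    (G : SimpleGraph V) : Prop :=
  ∃ v : V, G.IsSimplicial v ∧ (G.neighborSet v).ncard = d ∧ Nonempty (G.induce {v}ᶜ ≃g H)

/-- `G` is isomorphic to the one-vertex graph `K₁`. -/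
def IsKOne {V : Type u} (G : SimpleGraph V) : Prop :=
  Nonempty (G ≃g completeGraph (Fin 1))

/-- 2-trees: `K₂`, and every graph obtained from a 2-tree by adding a simplicial vertex of
degree 2. -/
inductive IsTwoTree : ∀ {V : Type u}, SimpleGraph V → Prop
  | base {V : Type u} (G : SimpleGraph V) : Nonempty (G ≃g completeGraph (Fin 2)) → IsTwoTree G
  | step {W V : Type u} (H : SimpleGraph W) (G : SimpleGraph V) :
      IsTwoTree H → IsSimplicialExtension 2 H G → IsTwoTree G

/-- Hollowed 2-trees: the cycles of length at least four, and every graph obtained from a hollowed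
2-tree by adding a simplicial vertex of degree 2. -/
inductive IsHollowedTwoTree : ∀ {V : Type u}, SimpleGraph V → Prop
  | base {V : Type u} (G : SimpleGraph V) (n : ℕ) : 4 ≤ n → Nonempty (G ≃g cycleGraph n) →
      IsHollowedTwoTree G
  | step {W V : Type u} (H : SimpleGraph W) (G : SimpleGraph V) :
      IsHollowedTwoTree H → IsSimplicialExtension 2 H G → IsHollowedTwoTree G

/-- The graphs that can be constructed from `K₁` or a cycle by a finite (possibly empty) sequence of
additions of simplicial vertices of degree 1 or 2. -/
inductive IsSimpliciallyConstructible : ∀ {V : Type u}, SimpleGraph V → Prop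
  | kOne {V : Type u} (G : SimpleGraph V) : IsKOne G → IsSimpliciallyConstructible G
  | cycle {V : Type u} (G : SimpleGraph V) (n : ℕ) : 3 ≤ n → Nonempty (G ≃g cycleGraph n) →
      IsSimpliciallyConstructible G
  | attachOne {W V : Type u} (H : SimpleGraph W) (G : SimpleGraph V) :
      IsSimpliciallyConstructible H → IsSimplicialExtension 1 H G → IsSimpliciallyConstructible G
  | attachTwo {W V : Type u} (H : SimpleGraph W) (G : SimpleGraph V) :
      IsSimpliciallyConstructible H → IsSimplicialExtension 2 H G → IsSimpliciallyConstructible G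

end SimpleGraph

/-!
For the four statements (1: orientation, 2: excluded induced minors, 3: blocks, 4: construction),
the implications 1 → 2 → 4 → 1 and 3 ↔ 4 are proved. Connectivity is handled on vertex sets,
through the predicate `ConnOn`; the names below are in the namespace `SimpleGraph`.

*1 → 2.* In a connected bag of an induced minor model, the arcs of an orientation with clique
out-neighborhoods form a locally confluent relation, so the bag has a root that can be reached
from all its vertices (`ConnOn.exists_root`). Of two adjacent bags, at least one has an arc from
its root to the other, which orients the minor in the same way
(`IsOnePerfectlyOrientable.exists_rel_of_isInducedMinor`). In a triangle-free graph each vertex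
then has at most one out-neighbor, so there are at most as many edges as vertices. Each of
`K_{2,3}`, `F₁` and `F₂` is triangle-free and has more edges than vertices.

*2 → 4.* Simplicial vertices are deleted as long as there are any; their degree is at most 2,
because `K₄` is excluded. What remains must be `K₁` or a cycle (`exists_iso_cycleGraph`): by
Dirac's argument (`exists_isFatCycle`), a graph without simplicial vertices has an induced cycle
of length at least 4. A component `K` of the rest is attached to a vertex or an edge of it, for
otherwise there is a minor `K₄` or an induced minor `K_{2,3}` (`IsIndCycle.exists_attachment`).
Dirac's argument applied to `K` and an edge `a a'` of the cycle containing its attachments gives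
a second cycle through `a`, one of whose parts is a connected set that may be large
(`IsFatCycle`). According to the position of `a'`, the two cycles form an induced minor `F₁` or
`F₂`, or there is a minor `K₄` (`IsFrame.isInducedMinor`).

*4 → 1.* The initial cycle is oriented cyclically, and each new vertex towards its neighbors.

*4 → 3.* A new vertex of degree 1 forms a new block `K₂` with its neighbor, and a new vertex of
degree 2 extends the block of its two neighbors (`IsSimpliciallyConstructible.hasTwoTreeBlocks`).

*3 → 4.* A connected set outside a block is attached to at most one of its vertices
(`IsBlockSet.eq_of_adj`). Starting from the exceptional block, or from a single vertex, the other
blocks are therefore added one by one along single vertices. A 2-tree can be built up starting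
from any of its edges (`IsTwoTree.reflTransGen_attachStep`), so adding one amounts to one new
vertex of degree 1 followed by new vertices of degree 2
(`HasTwoTreeBlocks.isSimpliciallyConstructible`).
-/

namespace SimpleGraph

/-! ### Connected vertex sets -/

/-- The vertex set `s` induces a preconnected subgraph of `G`, expressed by closure: a nonempty
subset of `s` from which no edge leads to the rest of `s` is all of `s`. -/
def ConnOn {V : Type u} (G : SimpleGraph V) (s : Set V) : Prop :=
  ∀ T ⊆ s, T.Nonempty → (∀ x ∈ T, ∀ y ∈ s, G.Adj x y → y ∈ T) → s ⊆ T

section ConnOn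

variable {V : Type u} {G : SimpleGraph V}

/-- It is enough to test the closed subsets through one given vertex. -/
theorem connOn_of_root {s : Set V} (r : V)
    (h : ∀ T ⊆ s, r ∈ T → (∀ x ∈ T, ∀ y ∈ s, G.Adj x y → y ∈ T) → s ⊆ T) (hr : r ∈ s) :
    G.ConnOn s := by
  intro T hT hne hcl
  by_cases hrT : r ∈ T
  · exact h T hT hrT hcl
  · -- the complement of a closed set is closed, too
    have := h (s \ T) Set.sdiff_subset ⟨hr, hrT⟩ (fun x hx y hy hxy =>
      ⟨hy, fun hyT => hx.2 (hcl y hyT x hx.1 hxy.symm)⟩)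
    obtain ⟨t, ht⟩ := hne
    exact absurd ht (this (hT ht)).2

theorem connOn_iff_preconnected {s : Set V} : G.ConnOn s ↔ (G.induce s).Preconnected := by
  constructor
  · intro h x y
    have := h {z | ∃ hz : z ∈ s, (G.induce s).Reachable x ⟨z, hz⟩} (fun z hz => hz.1)
      ⟨x, x.2, Reachable.refl _⟩ (by
        rintro z ⟨hz, hxz⟩ y hy hzy
        exact ⟨hy, hxz.trans (Adj.reachable (by simpa using hzy))⟩)
    obtain ⟨_, h2⟩ := this y.2
    exact h2
  · intro h T hT hne hcl y hy
    obtain ⟨t, ht⟩ := hne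
    obtain ⟨p⟩ := h ⟨t, hT ht⟩ ⟨y, hy⟩
    have key : ∀ (a b : s) (p : (G.induce s).Walk a b), (a : V) ∈ T → (b : V) ∈ T := by
      intro a b p
      induction p with
      | nil => exact id
      | cons hab _ ih => exact fun ha => ih (hcl _ ha _ (Subtype.coe_prop _) (by simpa using hab))
    exact key _ _ p ht

theorem connected_induce_iff_connOn {s : Set V} :
    (G.induce s).Connected ↔ G.ConnOn s ∧ s.Nonempty := by
  rw [connected_iff, connOn_iff_preconnected, Set.nonempty_coe_sort]

theorem connOn_univ_iff : G.ConnOn Set.univ ↔ G.Preconnected := by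
  rw [connOn_iff_preconnected]
  exact (induceUnivIso G).preconnected_iff

theorem connOn_singleton (x : V) : G.ConnOn {x} := by
  refine connOn_of_root x (fun T _ hx _ y hy => ?_) rfl
  rw [hy]; exact hx

theorem connOn_empty : G.ConnOn (∅ : Set V) := fun _ _ _ _ => Set.empty_subset _

theorem ConnOn.subset_of_closed {s T : Set V} (hs : G.ConnOn s) {r : V} (hr : r ∈ s) (hrT : r ∈ T)
    (h : ∀ x ∈ T, x ∈ s → ∀ y ∈ s, G.Adj x y → y ∈ T) : s ⊆ T := fun _ hz =>
  (hs (s ∩ T) Set.inter_subset_left ⟨r, hr, hrT⟩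
    (fun x hx y hy hxy => ⟨hy, h x hx.2 hx.1 y hy hxy⟩) hz).2

/-- A connected set that meets both `T` and its complement contains an edge leaving `T`. -/
theorem ConnOn.exists_adj {s T : Set V} (hs : G.ConnOn s) {x y : V} (hx : x ∈ s) (hxT : x ∈ T)
    (hy : y ∈ s) (hyT : y ∉ T) : ∃ a ∈ s, a ∈ T ∧ ∃ b ∈ s, b ∉ T ∧ G.Adj a b := by
  by_contra! hcon
  exact hyT (hs.subset_of_closed hx hxT
    (fun a ha has b hb hab => by_contra fun hbT => hcon a has ha b hb hbT hab) hy)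

theorem ConnOn.union_of_adj {s t : Set V} (hs : G.ConnOn s) (ht : G.ConnOn t) {x y : V}
    (hx : x ∈ s) (hy : y ∈ t) (hxy : G.Adj x y) : G.ConnOn (s ∪ t) := by
  refine connOn_of_root x (fun T _ hxT hcl => ?_) (Or.inl hx)
  exact Set.union_subset
    (hs.subset_of_closed hx hxT (fun a ha _ b hb hab => hcl a ha b (Or.inl hb) hab))
    (ht.subset_of_closed hy (hcl x hxT y (Or.inr hy) hxy)
      (fun a ha _ b hb hab => hcl a ha b (Or.inr hb) hab))

theorem ConnOn.insert_of_adj {s : Set V} (hs : G.ConnOn s) {x y : V} (hx : x ∈ s)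
    (hxy : G.Adj x y) : G.ConnOn (insert y s) := by
  rw [← Set.union_singleton]
  exact hs.union_of_adj (connOn_singleton y) hx rfl hxy

theorem connOn_pair {x y : V} (h : G.Adj x y) : G.ConnOn {x, y} :=
  (connOn_singleton y).insert_of_adj rfl h.symm

/-- A vertex whose neighbors in a connected set form a clique can be deleted from that set. -/
theorem ConnOn.sdiff_singleton_of_isClique {s : Set V} (hs : G.ConnOn s) {v : V}
    (hv : G.IsClique (s ∩ G.neighborSet v)) : G.ConnOn (s \ {v}) := by
  intro T hT hne hcl y hy
  obtain ⟨t, ht⟩ := hne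
  -- `T` stays closed after adding `v`, if one of the neighbors of `v` lies in `T`
  by_cases h : ∃ x ∈ T, G.Adj v x
  · obtain ⟨x, hxT, hvx⟩ := h
    have := hs.subset_of_closed (T := insert v T) (hT ht).1 (Or.inr ht) (by
      rintro a (rfl | ha) has b hb hab
      · right
        by_cases hbx : b = x
        · exact hbx ▸ hxT
        · refine hcl x hxT b ⟨hb, fun h => hab.ne h.symm⟩ ?_
          exact (hv ⟨hb, hab⟩ ⟨(hT hxT).1, hvx⟩ hbx).symm
      · by_cases hbv : b = v
        · exact Or.inl hbv
        · exact Or.inr (hcl a ha b ⟨hb, hbv⟩ hab))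
    exact (this hy.1).resolve_left hy.2
  · push Not at h
    refine hs.subset_of_closed (T := T) (hT ht).1 ht (fun a ha has b hb hab => ?_) hy.1
    by_cases hbv : b = v
    · exact absurd (hbv ▸ hab.symm) (h a ha)
    · exact hcl a ha b ⟨hb, hbv⟩ hab

/-- The connected component of `r` in the subgraph induced by `s`, for `r ∈ s`: the vertices lying in
all closed subsets of `s` that contain `r`. -/
def compOn (G : SimpleGraph V) (s : Set V) (r : V) : Set V :=
  {y | ∀ T ⊆ s, r ∈ T → (∀ x ∈ T, ∀ y ∈ s, G.Adj x y → y ∈ T) → y ∈ T}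

theorem mem_compOn (s : Set V) (r : V) : r ∈ G.compOn s r := fun _ _ h _ => h

theorem compOn_subset {s : Set V} {r : V} (hr : r ∈ s) : G.compOn s r ⊆ s := fun _ hy =>
  hy s subset_rfl hr (fun _ _ _ hy _ => hy)

theorem compOn_closed {s : Set V} {r x y : V} (hx : x ∈ G.compOn s r) (hy : y ∈ s)
    (hxy : G.Adj x y) : y ∈ G.compOn s r := fun T hT hr hcl =>
  hcl x (hx T hT hr hcl) y hy hxy

theorem connOn_compOn {s : Set V} {r : V} (hr : r ∈ s) : G.ConnOn (G.compOn s r) := by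
  refine connOn_of_root r (fun T hT hrT hcl y hy => ?_) (mem_compOn s r)
  exact hy T (hT.trans (compOn_subset hr)) hrT
    (fun x hx z hz hxz => hcl x hx z (compOn_closed (hT hx) hz hxz) hxz)

/-- A connected set splits into two connected sets separating two given vertices. -/
theorem ConnOn.exists_split {s : Set V} (hs : G.ConnOn s) {a b : V} (ha : a ∈ s) (hb : b ∈ s)
    (hab : a ≠ b) : ∃ s₁ s₂, s₁ ∪ s₂ = s ∧ Disjoint s₁ s₂ ∧ G.ConnOn s₁ ∧ G.ConnOn s₂ ∧
      a ∈ s₁ ∧ b ∈ s₂ := by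
  have has : a ∈ s \ {b} := ⟨ha, hab⟩
  have hsub := compOn_subset (G := G) has
  have hbs : b ∈ s \ G.compOn (s \ {b}) a := ⟨hb, fun h => (hsub h).2 rfl⟩
  refine ⟨G.compOn (s \ {b}) a, s \ G.compOn (s \ {b}) a,
    Set.union_sdiff_cancel fun x hx => (hsub hx).1, Set.disjoint_sdiff_right,
    connOn_compOn has, ?_, mem_compOn _ _, hbs⟩
  refine connOn_of_root b (fun T hT hbT hcl y hy => ?_) hbs
  have := hs.subset_of_closed (T := T ∪ G.compOn (s \ {b}) a) hb (Or.inl hbT) (by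
    intro x hx _ y hy hxy
    by_cases hyc : y ∈ G.compOn (s \ {b}) a
    · exact Or.inr hyc
    rcases hx with hx | hx
    · exact Or.inl (hcl x hx y ⟨hy, hyc⟩ hxy)
    · by_cases hyb : y = b
      · exact Or.inl (hyb ▸ hbT)
      · exact absurd (compOn_closed hx ⟨hy, hyb⟩ hxy) hyc)
  exact (this hy.1).resolve_right hy.2

theorem ConnOn.image {W : Type v} {H : SimpleGraph W} (f : H →g G) {s : Set W} (hs : H.ConnOn s) :
    G.ConnOn (f '' s) := by
  intro T hT hne hcl
  obtain ⟨t, ht⟩ := hne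
  obtain ⟨r, hr, rfl⟩ := hT ht
  rintro _ ⟨y, hy, rfl⟩
  exact hs.subset_of_closed (T := f ⁻¹' T) hr ht
    (fun a ha _ b hb hab => hcl _ ha _ ⟨b, hb, rfl⟩ (f.map_adj hab)) hy

theorem ConnOn.mono {G' : SimpleGraph V} (h : G ≤ G') {s : Set V} (hs : G.ConnOn s) :
    G'.ConnOn s := fun T hT hne hcl => hs T hT hne fun x hx y hy hxy => hcl x hx y hy (h hxy)

theorem connOn_image_iff {W : Type v} {H : SimpleGraph W} (f : H ↪g G) {s : Set W} :
    G.ConnOn (f '' s) ↔ H.ConnOn s := by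
  refine ⟨fun h T hT hne hcl y hy => ?_, fun h => h.image f.toHom⟩
  have := h (f '' T) (Set.image_mono hT) (hne.image f) (by
    rintro _ ⟨x, hx, rfl⟩ _ ⟨y, hy, rfl⟩ hxy
    exact ⟨y, hcl x hx y hy (f.map_adj_iff.1 hxy), rfl⟩)
  obtain ⟨z, hz, hzy⟩ := this ⟨y, hy, rfl⟩
  rwa [← f.injective hzy]

end ConnOn

/-! ### Orientations and induced minors -/

/-- In a connected set `s`, a relation orienting all edges of `G` such that the out-neighbors of
every vertex are pairwise adjacent has a root: a vertex lying in every nonempty out-closed subset.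
The clique condition makes the relation locally confluent, hence any two vertices of `s` have a
common successor; a vertex with the fewest successors is then a root. -/
theorem ConnOn.exists_root {V : Type u} {G : SimpleGraph V} {s : Set V} (hs : G.ConnOn s)
    (hne : s.Nonempty) (hfin : s.Finite) {R : V → V → Prop}
    (hR : ∀ x y, G.Adj x y → R x y ∨ R y x)
    (hcl : ∀ x y z, R x y → R x z → y ≠ z → G.Adj y z) :
    ∃ r ∈ s, ∀ T ⊆ s, T.Nonempty → (∀ x ∈ T, ∀ y ∈ s, R x y → y ∈ T) → r ∈ T := by
  let Q : V → V → Prop := fun x y => R x y ∧ y ∈ s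
  have hQs : ∀ x y, Relation.ReflTransGen Q x y → x ∈ s → y ∈ s := by
    intro x y h hx
    cases h with
    | refl => exact hx
    | tail _ h => exact h.2
  have hloc : ∀ a b c, Q a b → Q a c →
      ∃ d, Relation.ReflGen Q b d ∧ Relation.ReflTransGen Q c d := by
    intro a b c hab hac
    by_cases hbc : b = c
    · exact ⟨b, .refl, hbc ▸ .refl⟩
    · rcases hR b c (hcl a b c hab.1 hac.1 hbc) with h | h
      · exact ⟨c, .single ⟨h, hac.2⟩, .refl⟩
      · exact ⟨b, .refl, .single ⟨h, hab.2⟩⟩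
  -- any two vertices of `s` have a common successor
  have hjoin : ∀ x ∈ s, ∀ y ∈ s, Relation.Join (Relation.ReflTransGen Q) x y := by
    intro x hx y hy
    refine hs.subset_of_closed (T := {y | Relation.Join (Relation.ReflTransGen Q) x y}) hx
      ⟨x, .refl, .refl⟩ ?_ hy
    rintro a ⟨d, hxd, had⟩ has b hbs hab
    rcases hR a b hab with h | h
    · obtain ⟨e, hde, hbe⟩ := Relation.church_rosser hloc had (.single ⟨h, hbs⟩)
      exact ⟨e, hxd.trans hde, hbe⟩
    · exact ⟨d, hxd, .head ⟨h, has⟩ had⟩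
  obtain ⟨r, hr, hmin⟩ := Set.exists_min_image s
    (fun x => {y | Relation.ReflTransGen Q x y ∧ y ∈ s}.ncard) hfin hne
  -- a vertex with the fewest successors can be reached back from each of them
  have hback : ∀ y, Relation.ReflTransGen Q r y → Relation.ReflTransGen Q y r := by
    intro y hy
    have hys := hQs r y hy hr
    have := Set.eq_of_subset_of_ncard_le (s := {z | Relation.ReflTransGen Q y z ∧ z ∈ s})
      (t := {z | Relation.ReflTransGen Q r z ∧ z ∈ s})
      (fun z hz => ⟨hy.trans hz.1, hz.2⟩) (hmin y hys) (hfin.subset fun z hz => hz.2)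
    have hrr : r ∈ {z | Relation.ReflTransGen Q r z ∧ z ∈ s} := ⟨.refl, hr⟩
    rw [← this] at hrr
    exact hrr.1
  refine ⟨r, hr, fun T hT ⟨t, ht⟩ hclT => ?_⟩
  obtain ⟨d, hrd, htd⟩ := hjoin r hr t (hT ht)
  have htr := htd.trans (hback d hrd)
  clear hrd hback hmin hr
  induction htr with
  | refl => exact ht
  | tail _ hbc ih => exact hclT _ ih _ hbc.2 hbc.1

/-- An induced minor `H` of a 1-perfectly orientable graph can be oriented, possibly with some edges
oriented both ways, such that the out-neighbors of every vertex are pairwise adjacent: the arcs at a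
vertex of `H` are given by the arcs that leave the root of its bag. -/
theorem IsOnePerfectlyOrientable.exists_rel_of_isInducedMinor {V : Type u} [Finite V]
    {G : SimpleGraph V} (hG : G.IsOnePerfectlyOrientable) {W : Type v} {H : SimpleGraph W}
    (hH : H.IsInducedMinor G) :
    ∃ R : W → W → Prop, (∀ a b, H.Adj a b → R a b ∨ R b a) ∧
      ∀ a b c, R a b → R a c → a ≠ b → a ≠ c → b ≠ c → H.Adj b c := by
  obtain ⟨D, ⟨hD, -⟩, hcl⟩ := hG
  obtain ⟨S, hdisj, hconn, hadj⟩ := hH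
  have hS : ∀ a, G.ConnOn (S a) ∧ (S a).Nonempty := fun a =>
    connected_induce_iff_connOn.1 (hconn a)
  have hclq : ∀ x y z, D.Adj x y → D.Adj x z → y ≠ z → G.Adj y z := fun x y z hy hz hyz =>
    hcl x hy hz hyz
  choose r hr hroot using fun a => (hS a).1.exists_root (hS a).2 (Set.toFinite _)
    (R := D.Adj) (fun x y h => (hD x y).1 h) hclq
  refine ⟨fun a b => ∃ z ∈ S b, D.Adj (r a) z, fun a b hab => ?_, ?_⟩
  · by_contra! hcon
    have hdab := Set.disjoint_left.1 (hdisj hab.ne)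
    -- no arc leaves the root of `S b` for `S a`, so no arc at all leaves `S b` for a vertex
    -- of `S a` without an arc in the opposite direction
    have key : ∀ z ∈ S a, (∃ w ∈ S b, G.Adj z w) → ∃ w ∈ S b, D.Adj z w := by
      rintro z hz ⟨w, hw, hzw⟩
      by_contra! hno
      have hb := hroot b {t ∈ S b | D.Adj t z} (fun _ h => h.1)
        ⟨w, hw, ((hD z w).1 hzw).resolve_left (hno w hw)⟩ (by
          rintro t ⟨ht, htz⟩ y hy hty
          refine ⟨hy, ?_⟩
          have := hclq t z y htz hty (fun h => hdab hz (h ▸ hy))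
          exact ((hD z y).1 this).resolve_left (hno y hy))
      exact hcon.2 z hz hb.2
    obtain ⟨x, hx, y, hy, hxy⟩ := (hadj a b hab.ne).1 hab
    have ha := hroot a {t ∈ S a | ∃ w ∈ S b, D.Adj t w} (fun _ h => h.1)
        ⟨x, hx, key x hx ⟨y, hy, hxy⟩⟩ (by
          rintro t ⟨ht, w, hw, htw⟩ z hz htz
          exact ⟨hz, key z hz ⟨w, hw, hclq t z w htz htw (fun h => hdab hz (h ▸ hw))⟩⟩)
    obtain ⟨-, w, hw, haw⟩ := ha
    exact hcon.1 w hw haw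
  · rintro a b c ⟨y, hy, hay⟩ ⟨z, hz, haz⟩ - - hbc
    exact (hadj b c hbc).2 ⟨y, hy, z, hz, hclq _ y z hay haz
      (fun h => Set.disjoint_left.1 (hdisj hbc) hy (h ▸ hz))⟩

/-- A triangle-free induced minor of a 1-perfectly orientable graph has at most as many edges as
vertices, as each of its vertices is left by at most one arc. -/
theorem IsOnePerfectlyOrientable.card_edges_le {V : Type u} [Finite V]
    {G : SimpleGraph V} (hG : G.IsOnePerfectlyOrientable) {W : Type v} [Fintype W]
    {H : SimpleGraph W} (hH : H.IsInducedMinor G)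
    (htri : ∀ a b c, H.Adj a b → H.Adj a c → ¬ H.Adj b c) {m : ℕ} (p q : Fin m → W)
    (hadj : ∀ i, H.Adj (p i) (q i)) (hinj : Function.Injective fun i => s(p i, q i)) :
    m ≤ Fintype.card W := by
  obtain ⟨R, hR, hcl⟩ := hG.exists_rel_of_isInducedMinor hH
  have : ∀ i, ∃ x y, R x y ∧ H.Adj x y ∧ s(x, y) = s(p i, q i) := by
    intro i
    rcases hR _ _ (hadj i) with h | h
    · exact ⟨_, _, h, hadj i, rfl⟩
    · exact ⟨_, _, h, (hadj i).symm, Sym2.eq_swap⟩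
  choose f g hfg hadj' he using this
  have hf : Function.Injective f := by
    intro i j hij
    apply hinj
    change s(p i, q i) = s(p j, q j)
    rw [← he, ← he]
    have hij' := hadj' j
    have hR' := hfg j
    rw [← hij] at hij' hR' ⊢
    by_cases hg : g i = g j
    · rw [hg]
    · exact absurd (hcl _ _ _ (hfg i) hR' (hadj' i).ne hij'.ne hg) (htri _ _ _ (hadj' i) hij')
  simpa using Fintype.card_le_of_injective f hf

theorem graphF1_adj (a b : Fin 6) : graphF1.Adj a b ↔
    s(a, b) ∈ ({s(0, 1), s(1, 2), s(2, 3), s(3, 0), s(1, 4), s(4, 5), s(5, 0)} :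
      Finset (Sym2 (Fin 6))) ∧ a ≠ b := by
  simp [graphF1]

theorem graphF2_adj (a b : Fin 7) : graphF2.Adj a b ↔
    s(a, b) ∈ ({s(0, 1), s(1, 2), s(2, 3), s(3, 0), s(0, 4), s(4, 5), s(5, 6), s(6, 0)} :
      Finset (Sym2 (Fin 7))) ∧ a ≠ b := by
  simp [graphF2]

theorem IsOnePerfectlyOrientable.not_isInducedMinor {V : Type u} [Finite V] {G : SimpleGraph V}
    (hG : G.IsOnePerfectlyOrientable) :
    ¬ (completeBipartiteGraph (Fin 2) (Fin 3)).IsInducedMinor G ∧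
      ¬ graphF1.IsInducedMinor G ∧ ¬ graphF2.IsInducedMinor G := by
  refine ⟨fun h => ?_, fun h => ?_, fun h => ?_⟩
  · have := hG.card_edges_le h (by simp) (m := 6)
      ![.inl 0, .inl 0, .inl 0, .inl 1, .inl 1, .inl 1]
      ![.inr 0, .inr 1, .inr 2, .inr 0, .inr 1, .inr 2]
      (by intro i; fin_cases i <;> simp) (by decide)
    simp at this
  · have := hG.card_edges_le h (by simp only [graphF1_adj]; decide) (m := 7)
      ![0, 1, 2, 3, 1, 4, 5] ![1, 2, 3, 0, 4, 5, 0] (by simp only [graphF1_adj]; decide) (by decide)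
    simp at this
  · have := hG.card_edges_le h (by simp only [graphF2_adj]; decide) (m := 8)
      ![0, 1, 2, 3, 0, 4, 5, 6] ![1, 2, 3, 0, 4, 5, 6, 0] (by simp only [graphF2_adj]; decide)
      (by decide)
    simp at this

theorem IsOnePerfectlyOrientable.of_iso {V : Type u} {W : Type v} {G : SimpleGraph V}
    {H : SimpleGraph W} (e : G ≃g H) (hH : H.IsOnePerfectlyOrientable) :
    G.IsOnePerfectlyOrientable := by
  obtain ⟨D, ⟨h1, h2⟩, h3⟩ := hH
  refine ⟨⟨fun x y => D.Adj (e x) (e y)⟩, ⟨fun x y => ?_, fun x y => h2 _ _⟩,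
    fun x y hy z hz hyz => ?_⟩
  · rw [← h1, e.map_adj_iff]
  · exact e.map_adj_iff.1 (h3 _ hy hz (e.injective.ne hyz))

theorem isOnePerfectlyOrientable_cycleGraph {n : ℕ} (hn : 3 ≤ n) :
    (cycleGraph n).IsOnePerfectlyOrientable := by
  obtain ⟨n, rfl⟩ := Nat.exists_eq_add_of_le' hn
  refine ⟨⟨fun x y => y - x = 1⟩, ⟨fun x y => ?_, fun x y h h' => ?_⟩, fun x y hy z hz hyz => ?_⟩
  · rw [cycleGraph_adj]; exact or_comm
  · change y - x = 1 at h
    change x - y = 1 at h'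
    have : (1 : Fin (n + 3)) + 1 = 0 := by
      nth_rewrite 1 [← h]; rw [← h']; simp
    have := congrArg Fin.val this
    simp [Fin.val_add] at this
    rw [Nat.mod_eq_of_lt (by omega)] at this
    omega
  · have h : y - x = z - x := (show y - x = 1 from hy).trans (show z - x = 1 from hz).symm
    exact absurd (sub_left_inj.1 h) hyz

/-- New simplicial vertices are oriented towards their neighbors. -/
theorem IsOnePerfectlyOrientable.of_isSimplicial {V : Type u} {G : SimpleGraph V} {v : V}
    (hv : G.IsSimplicial v) (h : (G.induce {v}ᶜ).IsOnePerfectlyOrientable) :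
    G.IsOnePerfectlyOrientable := by
  obtain ⟨D, ⟨h1, h2⟩, h3⟩ := h
  let A : V → V → Prop := fun x y =>
    (x = v ∧ G.Adj v y) ∨ ∃ (hx : x ≠ v) (hy : y ≠ v), D.Adj ⟨x, hx⟩ ⟨y, hy⟩
  refine ⟨⟨A⟩, ⟨fun x y => ?_, fun x y hxy hyx => ?_⟩, fun x y hy z hz hyz => ?_⟩
  · by_cases hx : x = v
    · subst hx
      simp [A]
    · by_cases hy : y = v
      · subst hy
        simp [A, hx, G.adj_comm]
      · have := h1 ⟨x, hx⟩ ⟨y, hy⟩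
        simpa [A, hx, hy] using this
  · rcases hxy with ⟨rfl, h⟩ | ⟨hx, hy, h⟩
    · rcases hyx with ⟨rfl, h'⟩ | ⟨_, h', _⟩
      · exact h.ne rfl
      · exact h' rfl
    · rcases hyx with ⟨h', _⟩ | ⟨_, _, h'⟩
      · exact hy h'
      · exact h2 _ _ h h'
  · rcases hy with ⟨rfl, hy⟩ | ⟨hx, hy, hy'⟩
    · rcases hz with ⟨-, hz⟩ | ⟨hx, _⟩
      · exact hv hy hz hyz
      · exact absurd rfl hx
    · rcases hz with ⟨rfl, hz⟩ | ⟨_, hz, hz'⟩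
      · exact absurd rfl hx
      · exact h3 ⟨x, hx⟩ hy' hz' (fun h => hyz (congrArg Subtype.val h))

theorem IsSimpliciallyConstructible.isOnePerfectlyOrientable {V : Type u} {G : SimpleGraph V}
    (h : G.IsSimpliciallyConstructible) : G.IsOnePerfectlyOrientable := by
  induction h with
  | kOne G h =>
    obtain ⟨e⟩ := h
    refine .of_iso e ⟨⟨fun _ _ => False⟩, ⟨fun x y => ?_, fun _ _ h => h.elim⟩, fun _ _ h => h.elim⟩
    simp [Subsingleton.elim x y]
  | cycle G n hn h =>
    obtain ⟨e⟩ := h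
    exact .of_iso e (isOnePerfectlyOrientable_cycleGraph hn)
  | attachOne H G _ h ih =>
    obtain ⟨v, hv, -, ⟨e⟩⟩ := h
    exact .of_isSimplicial hv (.of_iso e ih)
  | attachTwo H G _ h ih =>
    obtain ⟨v, hv, -, ⟨e⟩⟩ := h
    exact .of_isSimplicial hv (.of_iso e ih)

/-! ### Building minor models -/

section Models

variable {V : Type u} {G : SimpleGraph V}

/-- A bag of a minor model: a nonempty connected vertex set. -/
def IsBag (G : SimpleGraph V) (A : Set V) : Prop := G.ConnOn A ∧ A.Nonempty

/-- The sets `A` and `B` are disjoint and joined by an edge. -/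
def Linked (G : SimpleGraph V) (A B : Set V) : Prop :=
  (∀ x ∈ A, x ∉ B) ∧ ∃ x ∈ A, ∃ y ∈ B, G.Adj x y

/-- The sets `A` and `B` are disjoint and no edge joins them. -/
def Apart (G : SimpleGraph V) (A B : Set V) : Prop :=
  ∀ x ∈ A, x ∉ B ∧ ∀ y ∈ B, ¬ G.Adj x y

theorem isBag_singleton (x : V) : G.IsBag {x} := ⟨connOn_singleton x, x, rfl⟩

theorem isMinor_of_lt {n : ℕ} {H : SimpleGraph (Fin n)} (S : Fin n → Set V)
    (hS : ∀ a, G.IsBag (S a)) (h : ∀ a b, a < b → G.Linked (S a) (S b)) : H.IsMinor G := by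
  refine ⟨S, fun a b hab => Set.disjoint_left.2 fun x hx hx' => ?_,
    fun a => connected_induce_iff_connOn.2 (hS a), fun a b hab => ?_⟩
  · rcases hab.lt_or_gt with h' | h'
    · exact (h _ _ h').1 x hx hx'
    · exact (h _ _ h').1 x hx' hx
  · rcases hab.ne.lt_or_gt with h' | h'
    · exact (h _ _ h').2
    · obtain ⟨x, hx, y, hy, hxy⟩ := (h _ _ h').2
      exact ⟨y, hy, x, hx, hxy.symm⟩

theorem isMinor_completeGraph_four {A B C D : Set V} (hA : G.IsBag A) (hB : G.IsBag B)
    (hC : G.IsBag C) (hD : G.IsBag D) (hAB : G.Linked A B) (hAC : G.Linked A C)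
    (hAD : G.Linked A D) (hBC : G.Linked B C) (hBD : G.Linked B D) (hCD : G.Linked C D) :
    (completeGraph (Fin 4)).IsMinor G := by
  refine isMinor_of_lt ![A, B, C, D] ?_ ?_
  · simp [Fin.forall_fin_succ, *]
  · simp [Fin.forall_fin_succ, *]

theorem isInducedMinor_of_lt {n : ℕ} {H : SimpleGraph (Fin n)} (S : Fin n → Set V)
    (hS : ∀ a, G.IsBag (S a)) (h : ∀ a b, a < b →
      (H.Adj a b → G.Linked (S a) (S b)) ∧ (¬ H.Adj a b → G.Apart (S a) (S b))) :
    H.IsInducedMinor G := by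
  have hd : ∀ a b, a < b → ∀ x ∈ S a, x ∉ S b := by
    intro a b hab x hx
    by_cases h' : H.Adj a b
    · exact ((h a b hab).1 h').1 x hx
    · exact ((h a b hab).2 h' x hx).1
  have hadj : ∀ a b, a < b → (H.Adj a b ↔ ∃ x ∈ S a, ∃ y ∈ S b, G.Adj x y) := by
    refine fun a b hab => ⟨fun h' => ((h a b hab).1 h').2, fun ⟨x, hx, y, hy, hxy⟩ => ?_⟩
    by_contra h'
    exact ((h a b hab).2 h' x hx).2 y hy hxy
  refine ⟨S, fun a b hab => Set.disjoint_left.2 fun x hx hx' => ?_,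
    fun a => connected_induce_iff_connOn.2 (hS a), fun a b hab => ?_⟩
  · rcases hab.lt_or_gt with h' | h'
    · exact hd _ _ h' x hx hx'
    · exact hd _ _ h' x hx' hx
  · rcases hab.lt_or_gt with h' | h'
    · exact hadj a b h'
    · rw [H.adj_comm, hadj b a h']
      exact ⟨fun ⟨x, hx, y, hy, hxy⟩ => ⟨y, hy, x, hx, hxy.symm⟩,
        fun ⟨x, hx, y, hy, hxy⟩ => ⟨y, hy, x, hx, hxy.symm⟩⟩

theorem isInducedMinor_graphF1 {A B C D E F : Set V} (hA : G.IsBag A) (hB : G.IsBag B)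
    (hC : G.IsBag C) (hD : G.IsBag D) (hE : G.IsBag E) (hF : G.IsBag F)
    (hAB : G.Linked A B) (hBC : G.Linked B C) (hCD : G.Linked C D) (hAD : G.Linked A D)
    (hBE : G.Linked B E) (hEF : G.Linked E F) (hAF : G.Linked A F)
    (hAC : G.Apart A C) (hBD : G.Apart B D) (hAE : G.Apart A E) (hBF : G.Apart B F)
    (hCE : G.Apart C E) (hCF : G.Apart C F) (hDE : G.Apart D E) (hDF : G.Apart D F) :
    graphF1.IsInducedMinor G := by
  refine isInducedMinor_of_lt ![A, B, C, D, E, F] ?_ ?_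
  · simp [Fin.forall_fin_succ, *]
  · simp [Fin.forall_fin_succ, graphF1, *]

theorem isInducedMinor_graphF2 {A B C D E F H : Set V} (hA : G.IsBag A) (hB : G.IsBag B)
    (hC : G.IsBag C) (hD : G.IsBag D) (hE : G.IsBag E) (hF : G.IsBag F) (hH : G.IsBag H)
    (hAB : G.Linked A B) (hBC : G.Linked B C) (hCD : G.Linked C D) (hAD : G.Linked A D)
    (hAE : G.Linked A E) (hEF : G.Linked E F) (hFH : G.Linked F H) (hAH : G.Linked A H)
    (hAC : G.Apart A C) (hBD : G.Apart B D) (hAF : G.Apart A F) (hEH : G.Apart E H)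
    (h : G.Apart (B ∪ (C ∪ D)) (E ∪ (F ∪ H))) :
    graphF2.IsInducedMinor G := by
  have hsub : ∀ P Q : Set V, P ⊆ B ∪ (C ∪ D) → Q ⊆ E ∪ (F ∪ H) → G.Apart P Q :=
    fun P Q hP hQ x hx => ⟨fun hx' => (h x (hP hx)).1 (hQ hx'), fun y hy => (h x (hP hx)).2 y (hQ hy)⟩
  have hBE := hsub B E (by grind) (by grind)
  have hBF := hsub B F (by grind) (by grind)
  have hBH := hsub B H (by grind) (by grind)
  have hCE := hsub C E (by grind) (by grind)
  have hCF := hsub C F (by grind) (by grind)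
  have hCH := hsub C H (by grind) (by grind)
  have hDE := hsub D E (by grind) (by grind)
  have hDF := hsub D F (by grind) (by grind)
  have hDH := hsub D H (by grind) (by grind)
  clear h hsub
  refine isInducedMinor_of_lt ![A, B, C, D, E, F, H] ?_ ?_
  · simp [Fin.forall_fin_succ, *]
  · simp [Fin.forall_fin_succ, graphF2, *]

theorem isInducedMinor_completeBipartiteGraph {A B C D E : Set V} (hA : G.IsBag A)
    (hB : G.IsBag B) (hC : G.IsBag C) (hD : G.IsBag D) (hE : G.IsBag E)
    (hAB : G.Apart A B) (hCD : G.Apart C D) (hCE : G.Apart C E) (hDE : G.Apart D E)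
    (hAC : G.Linked A C) (hAD : G.Linked A D) (hAE : G.Linked A E)
    (hBC : G.Linked B C) (hBD : G.Linked B D) (hBE : G.Linked B E) :
    (completeBipartiteGraph (Fin 2) (Fin 3)).IsInducedMinor G := by
  -- the model is indexed by `Fin 5` and then transported along `Fin 2 ⊕ Fin 3 ≃ Fin 5`
  let e : Fin 2 ⊕ Fin 3 ≃ Fin 5 := finSumFinEquiv
  obtain ⟨S, h1, h2, h3⟩ := isInducedMinor_of_lt (G := G)
    (H := (completeBipartiteGraph (Fin 2) (Fin 3)).comap e.symm) ![A, B, C, D, E]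
    (by simp [Fin.forall_fin_succ, *]) (by
      have : ∀ a b, ((completeBipartiteGraph (Fin 2) (Fin 3)).comap e.symm).Adj a b ↔
          (a < 2 ∧ 2 ≤ b ∨ b < 2 ∧ 2 ≤ a) := by
        simp only [comap_adj, completeBipartiteGraph_adj, e]
        decide
      simp only [this]
      simp [Fin.forall_fin_succ, *])
  refine ⟨fun a => S (e a), fun a b hab => h1 (e.injective.ne hab), fun a => h2 _, fun a b hab => ?_⟩
  rw [← h3 _ _ (e.injective.ne hab)]
  simp only [comap_adj, Equiv.symm_apply_apply]

end Models

/-! ### Simplicial vertices and long cycles -/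

section Dirac

variable {V : Type u} {G : SimpleGraph V}

/-- A cycle of length four in `W` with one of its vertices blown up to a connected set `X`; it is
induced in that its two pairs of opposite parts are not adjacent. -/
structure IsFatCycle (G : SimpleGraph V) (W X : Set V) (s t s' : V) : Prop where
  subset : X ⊆ W
  mem_left : s ∈ W
  mem_mid : t ∈ W
  mem_right : s' ∈ W
  conn : G.ConnOn X
  left_notMem : s ∉ X
  mid_notMem : t ∉ X
  right_notMem : s' ∉ X
  adj_left : ∃ x ∈ X, G.Adj x s
  adj_right : ∃ x ∈ X, G.Adj x s'
  mid_left : G.Adj t s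
  mid_right : G.Adj t s'
  ne : s ≠ s'
  not_adj : ¬ G.Adj s s'
  mid_not_adj : ∀ x ∈ X, ¬ G.Adj x t

theorem IsFatCycle.mono {W W' X : Set V} {s t s' : V} (h : G.IsFatCycle W X s t s')
    (hW : W ⊆ W') : G.IsFatCycle W' X s t s' :=
  { h with
    subset := h.subset.trans hW
    mem_left := hW h.mem_left
    mem_mid := hW h.mem_mid
    mem_right := hW h.mem_right }

/-- A wheel contains `K₄` as a minor. -/
theorem IsFatCycle.isMinor_of_hub {W X : Set V} {s t s' : V} (h : G.IsFatCycle W X s t s')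
    {a : V} (haX : a ∉ X) (hX : ∃ x ∈ X, G.Adj a x) (hs : G.Adj a s) (ht : G.Adj a t)
    (hs' : G.Adj a s') : (completeGraph (Fin 4)).IsMinor G := by
  obtain ⟨x, hx, hax⟩ := hX
  obtain ⟨y, hy, hys⟩ := h.adj_left
  obtain ⟨z, hz, hzs⟩ := h.adj_right
  have h1 := h.left_notMem
  have h2 := h.mid_notMem
  have h3 := h.right_notMem
  have h4 := h.mid_left
  have h5 := h.ne
  refine isMinor_completeGraph_four (A := {a}) (B := X) (C := {s}) (D := {t, s'})
    (isBag_singleton a) ⟨h.conn, x, hx⟩ (isBag_singleton s)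
    ⟨connOn_pair h.mid_right, t, by simp⟩ ⟨by simpa using haX, a, rfl, x, hx, hax⟩
    ⟨by simpa using hs.ne, a, rfl, s, rfl, hs⟩
    ⟨by simp [ht.ne, hs'.ne], a, rfl, t, by simp, ht⟩
    ⟨fun w hw hws => h1 (by rwa [← show w = s from hws]), y, hy, s, rfl, hys⟩
    ⟨?_, z, hz, s', by simp, hzs⟩ ⟨?_, s, rfl, t, by simp, h4.symm⟩
  · rintro w hw (rfl | rfl)
    exacts [h2 hw, h3 hw]
  · simp [h4.ne', h5]

/-- If `x` does not dominate `W`, a largest connected set `X` containing `x` that does not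
dominate `W` has the following property: every vertex not dominated by `X` is adjacent to all the
neighbors of `X`. -/
theorem exists_connOn_complete [Finite V] {W : Set V} {x y : V} (hx : x ∈ W) (hy : y ∈ W)
    (hyx : y ≠ x) (hxy : ¬ G.Adj x y) :
    ∃ X ⊆ W, x ∈ X ∧ G.ConnOn X ∧ (∃ b ∈ W, b ∉ X ∧ ∀ z ∈ X, ¬ G.Adj z b) ∧
      ∀ b ∈ W, b ∉ X → (∀ z ∈ X, ¬ G.Adj z b) → ∀ s ∈ W, s ∉ X → (∃ z ∈ X, G.Adj z s) →
        G.Adj s b := by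
  obtain ⟨X, -, ⟨hXW, hxX, hX, hB⟩, hmax⟩ := (Set.toFinite {X : Set V | X ⊆ W ∧ x ∈ X ∧
    G.ConnOn X ∧ ∃ b ∈ W, b ∉ X ∧ ∀ z ∈ X, ¬ G.Adj z b}).exists_le_maximal (a := {x})
    ⟨by simpa using hx, rfl, connOn_singleton x, y, hy, hyx, by simpa using hxy⟩
  refine ⟨X, hXW, hxX, hX, hB, fun b hb hbX hbz s hs hsX ⟨z, hz, hzs⟩ => ?_⟩
  by_contra hsb
  refine hsX (hmax ⟨Set.insert_subset hs hXW, Or.inr hxX, hX.insert_of_adj hz hzs, b, hb, ?_, ?_⟩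
    (Set.subset_insert s X) (Set.mem_insert s X))
  · rintro (rfl | h)
    · exact hbz z hz hzs
    · exact hbX h
  · rintro w (rfl | hw)
    · exact hsb
    · exact hbz w hw

/-- Dirac's theorem on simplicial vertices: if `A` is a clique and no vertex of `W` outside `A` is
simplicial in `W`, then `W` contains a fat 4-cycle. -/
theorem exists_isFatCycle [Finite V] (W A : Set V) (hA : G.IsClique A)
    (hne : ∃ w ∈ W, w ∉ A) (hsimp : ∀ w ∈ W, w ∉ A → ¬ G.IsClique (W ∩ G.neighborSet w)) :
    ∃ X s t s', G.IsFatCycle W X s t s' := by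
  induction hn : W.ncard using Nat.strong_induction_on generalizing W A with
  | _ n ih =>
  subst hn
  obtain ⟨x, hx, hxA⟩ : ∃ x ∈ W, x ∈ A ∨ A ∩ W = ∅ := by
    by_cases h : (A ∩ W).Nonempty
    · exact ⟨h.some, h.some_mem.2, Or.inl h.some_mem.1⟩
    · obtain ⟨w, hw, -⟩ := hne
      exact ⟨w, hw, Or.inr (Set.not_nonempty_iff_eq_empty.1 h)⟩
  by_cases hdom : ∀ y ∈ W, y ≠ x → G.Adj x y
  · -- a dominating vertex may be deleted
    have hne' : ∃ w ∈ W \ {x}, w ∉ A := by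
      obtain ⟨w, hw, hwA⟩ := hne
      by_cases hwx : w = x
      · subst hwx
        by_contra! hcon
        refine hsimp w hw hwA fun y hy z hz hyz => ?_
        exact hA (hcon y ⟨hy.1, hy.2.ne'⟩) (hcon z ⟨hz.1, hz.2.ne'⟩) hyz
      · exact ⟨w, ⟨hw, hwx⟩, hwA⟩
    obtain ⟨X, s, t, s', h⟩ := ih _ (Set.ncard_sdiff_singleton_lt_of_mem hx) (W \ {x}) A hA hne'
      (fun w hw hwA hcl => by
        refine hsimp w hw.1 hwA fun y hy z hz hyz => ?_
        by_cases hyx : y = x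
        · subst hyx; exact hdom z hz.1 hyz.symm
        by_cases hzx : z = x
        · subst hzx; exact (hdom y hy.1 hyz).symm
        exact hcl ⟨⟨hy.1, hyx⟩, hy.2⟩ ⟨⟨hz.1, hzx⟩, hz.2⟩ hyz) rfl
    exact ⟨X, s, t, s', h.mono Set.sdiff_subset⟩
  · push Not at hdom
    obtain ⟨y, hy, hyx, hxy⟩ := hdom
    obtain ⟨X, hXW, hxX, hX, ⟨b, hb, hbX, hbz⟩, hcomp⟩ := exists_connOn_complete hx hy hyx hxy
    by_cases hS : G.IsClique {s | s ∈ W ∧ s ∉ X ∧ ∃ z ∈ X, G.Adj z s}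
    · have hlt : {b | b ∈ W ∧ b ∉ X ∧ ∀ z ∈ X, ¬ G.Adj z b}.ncard < W.ncard :=
        Set.ncard_lt_ncard ⟨fun z hz => hz.1, fun h => (h hx).2.1 hxX⟩ (Set.toFinite W)
      obtain ⟨Y, s, t, s', h⟩ := ih _ hlt {b | b ∈ W ∧ b ∉ X ∧ ∀ z ∈ X, ¬ G.Adj z b} ∅ (by simp)
        ⟨b, ⟨hb, hbX, hbz⟩, by simp⟩ (fun w ⟨hw, hwX, hwz⟩ _ hcl => by
          refine hsimp w hw (fun hwA => ?_) fun p hp q hq hpq => ?_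
          · rcases hxA with hxA | hxA
            · exact hwz x hxX (hA hxA hwA (fun h => hwX (h ▸ hxX)))
            · exact (hxA ▸ (⟨hwA, hw⟩ : w ∈ A ∩ W) : w ∈ (∅ : Set V))
          · have hpX : p ∉ X := fun h => hwz p h hp.2.symm
            have hqX : q ∉ X := fun h => hwz q h hq.2.symm
            by_cases hpz : ∃ z ∈ X, G.Adj z p
            · by_cases hqz : ∃ z ∈ X, G.Adj z q
              · exact hS ⟨hp.1, hpX, hpz⟩ ⟨hq.1, hqX, hqz⟩ hpq
              · push Not at hqz
                exact hcomp q hq.1 hqX hqz p hp.1 hpX hpz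
            · push Not at hpz
              by_cases hqz : ∃ z ∈ X, G.Adj z q
              · exact (hcomp p hp.1 hpX hpz q hq.1 hqX hqz).symm
              · push Not at hqz
                exact hcl ⟨⟨hp.1, hpX, hpz⟩, hp.2⟩ ⟨⟨hq.1, hqX, hqz⟩, hq.2⟩ hpq) rfl
      exact ⟨Y, s, t, s', h.mono fun z hz => hz.1⟩
    · simp only [IsClique, Set.Pairwise] at hS
      push Not at hS
      obtain ⟨s, ⟨hs, hsX, hsz⟩, s', ⟨hs', hsX', hsz'⟩, hne, hnadj⟩ := hS
      exact ⟨X, s, b, s', hXW, hs, hb, hs', hX, hsX, hbX, hsX', hsz, hsz',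
        (hcomp b hb hbX hbz s hs hsX hsz).symm, (hcomp b hb hbX hbz s' hs' hsX' hsz').symm,
        hne, hnadj, hbz⟩

end Dirac

/-! ### The second cycle -/

section Frame

variable {V : Type u} {G : SimpleGraph V}

/-- The situation around a part `K` of the graph that is attached to an edge `a a'` of a cycle; the
rest of the cycle is divided into the connected parts `Q` and `Q'`, next to `a'` and `a`. -/
structure IsFrame (G : SimpleGraph V) (K : Set V) (a a' : V) (Q Q' : Set V) : Prop where
  nbr : ∀ x ∈ K, ∀ y, G.Adj x y → y ∈ K ∨ y = a ∨ y = a'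
  adj : G.Adj a a'
  left_notMem : a ∉ K
  right_notMem : a' ∉ K
  bagQ : G.IsBag Q
  bagQ' : G.IsBag Q'
  outQ : ∀ x ∈ Q, x ∉ K ∧ x ≠ a ∧ x ≠ a' ∧ ¬ G.Adj a x
  outQ' : ∀ x ∈ Q', x ∉ K ∧ x ≠ a ∧ x ≠ a' ∧ ¬ G.Adj a' x
  linked : G.Linked Q Q'
  adjQ : ∃ x ∈ Q, G.Adj a' x
  adjQ' : ∃ x ∈ Q', G.Adj a x

variable {K Q Q' : Set V} {a a' : V}

theorem IsFrame.symm (h : G.IsFrame K a a' Q Q') : G.IsFrame K a' a Q' Q where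
  nbr x hx y hxy := (h.nbr x hx y hxy).imp_right Or.symm
  adj := h.adj.symm
  left_notMem := h.right_notMem
  right_notMem := h.left_notMem
  bagQ := h.bagQ'
  bagQ' := h.bagQ
  outQ x hx := ⟨(h.outQ' x hx).1, (h.outQ' x hx).2.2.1, (h.outQ' x hx).2.1, (h.outQ' x hx).2.2.2⟩
  outQ' x hx := ⟨(h.outQ x hx).1, (h.outQ x hx).2.2.1, (h.outQ x hx).2.1, (h.outQ x hx).2.2.2⟩
  linked := ⟨fun x hx hx' => h.linked.1 x hx' hx, by
    obtain ⟨x, hx, y, hy, hxy⟩ := h.linked.2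
    exact ⟨y, hy, x, hx, hxy.symm⟩⟩
  adjQ := h.adjQ'
  adjQ' := h.adjQ

/-- A second cycle through the edge `a a'`. -/
theorem IsFrame.isInducedMinor_graphF1 (h : G.IsFrame K a a' Q Q') {Y Y' P R : Set V}
    (hY : G.ConnOn Y) (hY' : G.ConnOn Y') (haY : a ∈ Y) (haY' : a' ∈ Y')
    (hYK : Y ⊆ insert a K) (hYK' : Y' ⊆ insert a' K) (hYY' : ∀ x ∈ Y, x ∉ Y')
    (hP : G.IsBag P) (hR : G.IsBag R) (hPK : P ⊆ K) (hRK : R ⊆ K)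
    (hYP : G.Linked Y P) (hPR : G.Linked P R) (hRY' : G.Linked Y' R)
    (hPY' : G.Apart Y' P) (hRY : G.Apart Y R) : graphF1.IsInducedMinor G := by
  have hQK : ∀ Z ⊆ K, G.Apart Q Z ∧ G.Apart Q' Z := fun Z hZ =>
    ⟨fun x hx => ⟨fun hxZ => (h.outQ x hx).1 (hZ hxZ), fun y hy hxy => by
      have := h.nbr y (hZ hy) x hxy.symm
      have := h.outQ x hx
      tauto⟩,
    fun x hx => ⟨fun hxZ => (h.outQ' x hx).1 (hZ hxZ), fun y hy hxy => by
      have := h.nbr y (hZ hy) x hxy.symm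
      have := h.outQ' x hx
      tauto⟩⟩
  obtain ⟨q, hq, hqa⟩ := h.adjQ
  obtain ⟨q', hq', hqa'⟩ := h.adjQ'
  refine SimpleGraph.isInducedMinor_graphF1 (A := Y) (B := Y') (C := Q) (D := Q') (E := R) (F := P)
    ⟨hY, a, haY⟩ ⟨hY', a', haY'⟩ h.bagQ h.bagQ' hR hP ⟨hYY', a, haY, a', haY', h.adj⟩
    ⟨fun x hx hxQ => ?_, a', haY', q, hq, hqa⟩ h.linked ⟨fun x hx hxQ => ?_, a, haY, q', hq', hqa'⟩
    hRY' ?_ hYP ?_ ?_ hRY hPY' (hQK R hRK).1 (hQK P hPK).1 (hQK R hRK).2 (hQK P hPK).2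
  · have := h.outQ x hxQ
    have := hYK' hx
    simp at this; tauto
  · have := h.outQ' x hxQ
    have := hYK hx
    simp at this; tauto
  · obtain ⟨h1, x, hx, y, hy, hxy⟩ := hPR
    exact ⟨fun x hx hx' => h1 x hx' hx, y, hy, x, hx, hxy.symm⟩
  · intro x hx
    refine ⟨fun hxQ => ?_, fun y hy hxy => ?_⟩
    · have := h.outQ x hxQ
      have := hYK hx
      simp at this; tauto
    · have := h.outQ y hy
      rcases hYK hx with rfl | hx
      · tauto
      · have := h.nbr x hx y hxy; tauto
  · intro x hx
    refine ⟨fun hxQ => ?_, fun y hy hxy => ?_⟩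
    · have := h.outQ' x hxQ
      have := hYK' hx
      simp at this; tauto
    · have := h.outQ' y hy
      rcases hYK' hx with rfl | hx
      · tauto
      · have := h.nbr x hx y hxy; tauto

/-- A second cycle sharing with the first one only the part `Y` containing `a`. -/
theorem IsFrame.isInducedMinor_graphF2 (h : G.IsFrame K a a' Q Q') {Y Y' : Set V} {s t s' : V}
    (hY : G.ConnOn Y) (hY' : G.ConnOn Y') (haY : a ∈ Y) (haY' : a' ∈ Y')
    (hYK : Y ⊆ insert a K) (hYK' : Y' ⊆ insert a' K) (hYY' : ∀ x ∈ Y, x ∉ Y')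
    (hs : s ∈ K) (ht : t ∈ K) (hs' : s' ∈ K) (hsY : s ∉ Y ∪ Y') (htY : t ∉ Y ∪ Y')
    (hsY' : s' ∉ Y ∪ Y') (h1 : ∃ x ∈ Y, G.Adj x s) (h2 : ∃ x ∈ Y, G.Adj x s')
    (h3 : ∀ x ∈ Y ∪ Y', ¬ G.Adj x t) (h4 : ∀ x ∈ Y', ¬ G.Adj x s) (h5 : ∀ x ∈ Y', ¬ G.Adj x s')
    (hst : G.Adj t s) (hst' : G.Adj t s') (hne : s ≠ s') (hss : ¬ G.Adj s s') :
    graphF2.IsInducedMinor G := by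
  obtain ⟨q, hq, hqa⟩ := h.adjQ
  obtain ⟨q', hq', hqa'⟩ := h.adjQ'
  obtain ⟨x, hx, hxs⟩ := h1
  obtain ⟨x', hx', hxs'⟩ := h2
  simp only [Set.mem_union, not_or] at hsY htY hsY' h3
  refine SimpleGraph.isInducedMinor_graphF2 (A := Y) (B := Y') (C := Q) (D := Q') (E := {s})
    (F := {t}) (H := {s'}) ⟨hY, a, haY⟩ ⟨hY', a', haY'⟩ h.bagQ h.bagQ' (isBag_singleton s)
    (isBag_singleton t) (isBag_singleton s') ⟨hYY', a, haY, a', haY', h.adj⟩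
    ⟨fun x hx hxQ => ?_, a', haY', q, hq, hqa⟩ h.linked ⟨fun x hx hxQ => ?_, a, haY, q', hq', hqa'⟩
    ⟨?_, x, hx, s, rfl, hxs⟩ ⟨by simpa using hst.ne', s, rfl, t, rfl, hst.symm⟩
    ⟨by simpa using hst'.ne, t, rfl, s', rfl, hst'⟩ ⟨?_, x', hx', s', rfl, hxs'⟩ ?_ ?_ ?_ ?_ ?_
  · have := h.outQ x hxQ
    have := hYK' hx
    simp at this; tauto
  · have := h.outQ' x hxQ
    have := hYK hx
    simp at this; tauto
  · rintro z hz rfl; tauto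
  · rintro z hz rfl; tauto
  · intro x hx
    refine ⟨fun hxQ => ?_, fun y hy hxy => ?_⟩
    · have := h.outQ x hxQ
      have := hYK hx
      simp at this; tauto
    · have := h.outQ y hy
      rcases hYK hx with rfl | hx
      · tauto
      · have := h.nbr x hx y hxy; tauto
  · intro x hx
    refine ⟨fun hxQ => ?_, fun y hy hxy => ?_⟩
    · have := h.outQ' x hxQ
      have := hYK' hx
      simp at this; tauto
    · have := h.outQ' y hy
      rcases hYK' hx with rfl | hx
      · tauto
      · have := h.nbr x hx y hxy; tauto
  · rintro z hz
    refine ⟨?_, ?_⟩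
    · rintro rfl; tauto
    · rintro _ rfl; exact h3 z (Or.inl hz)
  · rintro _ rfl
    refine ⟨hne, ?_⟩
    rintro _ rfl; exact hss
  · have key : ∀ y ∈ K, ∀ z ∈ Q ∪ Q', z ≠ y ∧ ¬ G.Adj z y := by
      rintro y hy z (hz | hz)
      · have := h.outQ z hz
        refine ⟨by rintro rfl; tauto, fun hzy => ?_⟩
        have := h.nbr y hy z hzy.symm
        tauto
      · have := h.outQ' z hz
        refine ⟨by rintro rfl; tauto, fun hzy => ?_⟩
        have := h.nbr y hy z hzy.symm
        tauto
    have key' : ∀ y, (y = s ∨ y = t ∨ y = s') → ∀ z ∈ Y' ∪ (Q ∪ Q'), z ≠ y ∧ ¬ G.Adj z y := by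
      rintro y hy z (hz | hz)
      · rcases hy with rfl | rfl | rfl
        · exact ⟨by rintro rfl; tauto, h4 z hz⟩
        · exact ⟨by rintro rfl; tauto, h3 z (Or.inr hz)⟩
        · exact ⟨by rintro rfl; tauto, h5 z hz⟩
      · refine key y ?_ z hz
        rcases hy with rfl | rfl | rfl <;> assumption
    exact fun z hz => ⟨fun hz' => (key' z hz' z hz).1 rfl, fun y hy => (key' y hy z hz).2⟩

end Frame

section Frame

variable {V : Type u} {G : SimpleGraph V} {K Q Q' : Set V} {a a' : V}

/-- A second cycle through both `a` and `a'`, with the vertices `s` and `s'` next to the connected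
parts `Y` and `Y'`. One of the two edges that may join `s'` to `Y` and `s` to `Y'` is contracted
away; if both are present, there is a `K₄`-minor. -/
theorem IsFrame.isInducedMinor_graphF1_of_split (h : G.IsFrame K a a' Q Q')
    (hK4 : ¬ (completeGraph (Fin 4)).IsMinor G) {Y Y' : Set V} {s t s' : V}
    (hY : G.ConnOn Y) (hY' : G.ConnOn Y') (haY : a ∈ Y) (haY' : a' ∈ Y')
    (hYK : Y ⊆ insert a K) (hYK' : Y' ⊆ insert a' K) (hYY' : ∀ x ∈ Y, x ∉ Y')
    (hs : s ∈ K) (ht : t ∈ K) (hs' : s' ∈ K) (hsY : s ∉ Y ∪ Y') (htY : t ∉ Y ∪ Y')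
    (hsY' : s' ∉ Y ∪ Y') (h1 : ∃ x ∈ Y, G.Adj x s) (h2 : ∃ x ∈ Y', G.Adj x s')
    (h3 : ∀ x ∈ Y ∪ Y', ¬ G.Adj x t) (hst : G.Adj t s) (hst' : G.Adj t s') (hne : s ≠ s')
    (hss : ¬ G.Adj s s') : graphF1.IsInducedMinor G := by
  obtain ⟨x, hx, hxs⟩ := h1
  obtain ⟨x', hx', hxs'⟩ := h2
  simp only [Set.mem_union, not_or] at hsY htY hsY' h3
  by_cases hc : ∃ z ∈ Y, G.Adj z s'
  · by_cases hc' : ∃ z ∈ Y', G.Adj z s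
    · -- `Y`, `Y'`, `s` and `{t, s'}` are the bags of a `K₄`-minor
      obtain ⟨z, hz, hzs⟩ := hc
      obtain ⟨z', hz', hzs'⟩ := hc'
      refine absurd ?_ hK4
      refine isMinor_completeGraph_four (A := Y) (B := Y') (C := {s}) (D := {t, s'})
        ⟨hY, a, haY⟩ ⟨hY', a', haY'⟩ (isBag_singleton s) ⟨connOn_pair hst', t, by simp⟩
        ⟨hYY', a, haY, a', haY', h.adj⟩ ⟨?_, x, hx, s, rfl, hxs⟩ ⟨?_, z, hz, s', by simp, hzs⟩
        ⟨?_, z', hz', s, rfl, hzs'⟩ ⟨?_, x', hx', s', by simp, hxs'⟩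
        ⟨by simp [hst.ne', hne], s, rfl, t, by simp, hst.symm⟩
      · rintro w hw rfl; tauto
      · rintro w hw (rfl | rfl) <;> tauto
      · rintro w hw rfl; tauto
      · rintro w hw (rfl | rfl) <;> tauto
    · -- contract `s'` into `Y'`
      push Not at hc'
      refine h.isInducedMinor_graphF1 (Y := Y) (Y' := insert s' Y') (P := {s}) (R := {t}) hY
        (hY'.insert_of_adj hx' hxs') haY (Or.inr haY') hYK
        (Set.insert_subset (Or.inr hs') hYK') ?_ (isBag_singleton s) (isBag_singleton t)
        (by simpa using hs) (by simpa using ht) ⟨?_, x, hx, s, rfl, hxs⟩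
        ⟨by simpa using hst.ne', s, rfl, t, rfl, hst.symm⟩ ⟨?_, s', by simp, t, rfl, hst'.symm⟩
        ?_ ?_
      · rintro w hw (rfl | hw'); exacts [hsY'.1 hw, hYY' w hw hw']
      · rintro w hw rfl; tauto
      · rintro w (rfl | hw) hwt
        · exact hst'.ne' hwt
        · exact htY.2 (by rwa [← show w = t from hwt])
      · rintro w (rfl | hw)
        · exact ⟨hne.symm, by rintro _ rfl h; exact hss h.symm⟩
        · exact ⟨by rintro rfl; exact hsY.2 hw, by rintro _ rfl; exact hc' w hw⟩
      · exact fun w hw => ⟨by rintro rfl; exact htY.1 hw, by rintro _ rfl; exact h3 w (Or.inl hw)⟩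
  · -- contract `s` into `Y`
    push Not at hc
    refine h.isInducedMinor_graphF1 (Y := insert s Y) (Y' := Y') (P := {t}) (R := {s'})
      (hY.insert_of_adj hx hxs) hY' (Or.inr haY) haY' (Set.insert_subset (Or.inr hs) hYK) hYK' ?_
      (isBag_singleton t) (isBag_singleton s') (by simpa using ht) (by simpa using hs')
      ⟨?_, s, by simp, t, rfl, hst.symm⟩ ⟨by simpa using hst'.ne, t, rfl, s', rfl, hst'⟩
      ⟨?_, x', hx', s', rfl, hxs'⟩ ?_ ?_
    · rintro w (rfl | hw); exacts [hsY.2, hYY' w hw]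
    · rintro w (rfl | hw) hwt
      · exact hst.ne' hwt
      · exact htY.1 (by rwa [← show w = t from hwt])
    · rintro w hw rfl; tauto
    · exact fun w hw => ⟨by rintro rfl; exact htY.2 hw, by rintro _ rfl; exact h3 w (Or.inr hw)⟩
    · rintro w (rfl | hw)
      · exact ⟨hne, by rintro _ rfl; exact hss⟩
      · exact ⟨by rintro rfl; exact hsY'.1 hw, by rintro _ rfl; exact hc w hw⟩

/-- If `G` has no `K₄`-minor and `K` contains no simplicial vertex, then a fat 4-cycle through `a`
is found in `K ∪ {a, a'}`, which together with the first cycle yields one of `F₁` and `F₂`. -/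
theorem IsFrame.isInducedMinor [Finite V] (h : G.IsFrame K a a' Q Q')
    (hK4 : ¬ (completeGraph (Fin 4)).IsMinor G) (hK : G.ConnOn K) (haK : ∃ x ∈ K, G.Adj a x)
    (hsimp : ∀ v ∈ K, ¬ G.IsSimplicial v) :
    graphF1.IsInducedMinor G ∨ graphF2.IsInducedMinor G := by
  obtain ⟨k, hk, hak⟩ := haK
  set W : Set V := insert a (insert a' K) with hW
  have haW : a ∈ W := by simp [hW]
  have haW' : a' ∈ W := by simp [hW]
  have hKW : K ⊆ W := fun x hx => by simp [hW, hx]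
  have hWK : ∀ x ∈ W, x ≠ a → x ≠ a' → x ∈ K := by
    rintro x (rfl | rfl | hx) h1 h2 <;> tauto
  have hWconn : G.ConnOn W := by
    have h1 : G.ConnOn (insert a K) := hK.insert_of_adj hk hak.symm
    have h2 := h1.insert_of_adj (Set.mem_insert a K) h.adj
    rwa [Set.insert_comm] at h2
  have hNW : ∀ x ∈ K, ∀ y, G.Adj x y → y ∈ W := by
    intro x hx y hxy
    rcases h.nbr x hx y hxy with hy | rfl | rfl
    exacts [hKW hy, haW, haW']
  by_cases hdom : ∀ y ∈ W, y ≠ a → G.Adj a y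
  · refine absurd ?_ hK4
    obtain ⟨X, s, t, s', hX⟩ := exists_isFatCycle (G := G) (W \ {a}) {a'} (by simp)
      ⟨k, ⟨hKW hk, hak.ne'⟩, fun h' => h.right_notMem (by rwa [← show k = a' from h'])⟩ (by
        rintro w ⟨hw, hwa⟩ hwa' hcl
        have hwK := hWK w hw hwa hwa'
        refine hsimp w hwK fun p hp q hq hpq => ?_
        have hpW := hNW w hwK p hp
        have hqW := hNW w hwK q hq
        by_cases hpa : p = a
        · subst hpa; exact hdom q hqW hpq.symm
        by_cases hqa : q = a
        · subst hqa; exact (hdom p hpW hpq).symm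
        exact hcl ⟨⟨hpW, hpa⟩, hp⟩ ⟨⟨hqW, hqa⟩, hq⟩ hpq)
    have hd : ∀ y ∈ W \ {a}, G.Adj a y := fun y hy => hdom y hy.1 hy.2
    obtain ⟨x, hx, -⟩ := hX.adj_left
    exact hX.isMinor_of_hub (fun h' => (hX.subset h').2 rfl) ⟨x, hx, hd x (hX.subset hx)⟩
      (hd _ hX.mem_left) (hd _ hX.mem_mid) (hd _ hX.mem_right)
  push Not at hdom
  obtain ⟨y, hy, hya, hay⟩ := hdom
  obtain ⟨X, hXW, haX, hX, ⟨t, ht, htX, htz⟩, hcomp⟩ := exists_connOn_complete haW hy hya hay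
  have hBK : ∀ b ∈ W, b ∉ X → (∀ z ∈ X, ¬ G.Adj z b) → b ∈ K := fun b hb hbX hbz =>
    hWK b hb (fun h' => hbX (h' ▸ haX)) (fun h' => hbz a haX (h' ▸ h.adj))
  have htK := hBK t ht htX htz
  by_cases hS : G.IsClique {s | s ∈ W ∧ s ∉ X ∧ ∃ z ∈ X, G.Adj z s}
  · -- the vertices not dominated by `X` are adjacent to a common vertex `s`
    refine absurd ?_ hK4
    obtain ⟨z, -, hz, s, hs, hsX, hzs⟩ := hWconn.exists_adj haW haX ht htX
    obtain ⟨Y, p, q, p', hY⟩ := exists_isFatCycle (G := G)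
      {b | b ∈ W ∧ b ∉ X ∧ ∀ z ∈ X, ¬ G.Adj z b} ∅ (by simp) ⟨t, ⟨ht, htX, htz⟩, by simp⟩ (by
        rintro w ⟨hw, hwX, hwz⟩ - hcl
        have hwK := hBK w hw hwX hwz
        refine hsimp w hwK fun p hp q hq hpq => ?_
        have hpW := hNW w hwK p hp
        have hqW := hNW w hwK q hq
        have hpX : p ∉ X := fun h => hwz p h hp.symm
        have hqX : q ∉ X := fun h => hwz q h hq.symm
        by_cases hpz : ∃ z ∈ X, G.Adj z p
        · by_cases hqz : ∃ z ∈ X, G.Adj z q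
          · exact hS ⟨hpW, hpX, hpz⟩ ⟨hqW, hqX, hqz⟩ hpq
          · push Not at hqz
            exact hcomp q hqW hqX hqz p hpW hpX hpz
        · push Not at hpz
          by_cases hqz : ∃ z ∈ X, G.Adj z q
          · exact (hcomp p hpW hpX hpz q hqW hqX hqz).symm
          · push Not at hqz
            exact hcl ⟨⟨hpW, hpX, hpz⟩, hp⟩ ⟨⟨hqW, hqX, hqz⟩, hq⟩ hpq)
    have hd : ∀ b ∈ {b | b ∈ W ∧ b ∉ X ∧ ∀ z ∈ X, ¬ G.Adj z b}, G.Adj s b := fun b hb =>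
      hcomp b hb.1 hb.2.1 hb.2.2 s hs hsX ⟨z, hz, hzs⟩
    obtain ⟨x, hx, -⟩ := hY.adj_left
    exact hY.isMinor_of_hub (fun h' => (hY.subset h').2.2 z hz hzs) ⟨x, hx, hd x (hY.subset hx)⟩
      (hd _ hY.mem_left) (hd _ hY.mem_mid) (hd _ hY.mem_right)
  simp only [IsClique, Set.Pairwise] at hS
  push Not at hS
  obtain ⟨s, ⟨hs, hsX, hsz⟩, s', ⟨hs', hsX', hsz'⟩, hne, hnadj⟩ := hS
  have hts := (hcomp t ht htX htz s hs hsX hsz).symm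
  have hts' := (hcomp t ht htX htz s' hs' hsX' hsz').symm
  have hKX : ∀ x ∈ W, x ∉ X → x ≠ a' → x ∈ K := fun x hx hxX hx' =>
    hWK x hx (fun h' => hxX (h' ▸ haX)) hx'
  by_cases haX' : a' ∈ X
  · obtain ⟨Y, Y', rfl, hdisj, hY, hY', haY, haY'⟩ := hX.exists_split haX haX' h.adj.ne
    rw [Set.disjoint_left] at hdisj
    have hYK : Y ⊆ insert a K := by
      intro x hx
      by_cases hxa : x = a
      · exact Or.inl hxa
      · exact Or.inr (hWK x (hXW (Or.inl hx)) hxa (fun h' => hdisj hx (h' ▸ haY')))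
    have hYK' : Y' ⊆ insert a' K := by
      intro x hx
      by_cases hxa : x = a'
      · exact Or.inl hxa
      · exact Or.inr (hWK x (hXW (Or.inr hx)) (fun h' => hdisj haY (h' ▸ hx)) hxa)
    have hsK := hKX s hs hsX (fun h' => hsX (h' ▸ haX'))
    have hsK' := hKX s' hs' hsX' (fun h' => hsX' (h' ▸ haX'))
    have hor : ∀ v, (∃ z ∈ Y ∪ Y', G.Adj z v) → (∃ z ∈ Y, G.Adj z v) ∨ ∃ z ∈ Y', G.Adj z v := by
      rintro v ⟨z, hz | hz, hzv⟩
      exacts [Or.inl ⟨z, hz, hzv⟩, Or.inr ⟨z, hz, hzv⟩]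
    by_cases h1 : (∃ z ∈ Y, G.Adj z s) ∧ ∃ z ∈ Y', G.Adj z s'
    · exact Or.inl (h.isInducedMinor_graphF1_of_split hK4 hY hY' haY haY' hYK hYK'
        (fun x hx => hdisj hx) hsK htK hsK' hsX htX hsX' h1.1 h1.2 htz hts hts' hne hnadj)
    by_cases h2 : (∃ z ∈ Y, G.Adj z s') ∧ ∃ z ∈ Y', G.Adj z s
    · exact Or.inl (h.isInducedMinor_graphF1_of_split hK4 hY hY' haY haY' hYK hYK'
        (fun x hx => hdisj hx) hsK' htK hsK hsX' htX hsX h2.1 h2.2 htz hts' hts hne.symm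
        (fun h' => hnadj h'.symm))
    -- otherwise `s` and `s'` have neighbors in the same one of the two parts only
    have hs1 := hor s hsz
    have hs2 := hor s' hsz'
    right
    by_cases h3 : ∃ z ∈ Y, G.Adj z s
    · have h4 : ∀ x ∈ Y', ¬ G.Adj x s' := fun x hx hxs => h1 ⟨h3, x, hx, hxs⟩
      have h5 : ∃ z ∈ Y, G.Adj z s' := hs2.resolve_right (fun ⟨z, hz, hzs⟩ => h4 z hz hzs)
      exact h.isInducedMinor_graphF2 hY hY' haY haY' hYK hYK' (fun x hx => hdisj hx) hsK htK hsK'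
        hsX htX hsX' h3 h5 htz (fun x hx hxs => h2 ⟨h5, x, hx, hxs⟩) h4 hts hts' hne hnadj
    · have h4 := hs1.resolve_left h3
      have h5 : ¬ ∃ z ∈ Y, G.Adj z s' := fun h' => h2 ⟨h', h4⟩
      rw [Set.union_comm] at hsX htX hsX' htz
      push Not at h3 h5
      exact h.symm.isInducedMinor_graphF2 hY' hY haY' haY hYK' hYK (fun x hx hx' => hdisj hx' hx)
        hsK htK hsK' hsX htX hsX' h4 (hs2.resolve_left (by push Not; exact h5)) htz h3 h5 hts hts'
        hne hnadj
  · have hXK : X ⊆ insert a K := by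
      intro x hx
      by_cases hxa : x = a
      · exact Or.inl hxa
      · exact Or.inr (hWK x (hXW hx) hxa (fun h' => haX' (h' ▸ hx)))
    have hat : G.Adj t a' := (hcomp t ht htX htz a' haW' haX' ⟨a, haX, h.adj⟩).symm
    by_cases hp : ∃ p ∈ W, p ∉ X ∧ (∃ z ∈ X, G.Adj z p) ∧ p ≠ a' ∧ ¬ G.Adj a' p
    · obtain ⟨p, hpW, hpX, ⟨z, hz, hzp⟩, hpa, hap⟩ := hp
      have htp := (hcomp t ht htX htz p hpW hpX ⟨z, hz, hzp⟩).symm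
      have hpK := hKX p hpW hpX hpa
      left
      refine h.isInducedMinor_graphF1 (Y := X) (Y' := {a'}) (P := {p}) (R := {t}) hX
        (connOn_singleton a') haX rfl hXK (by simp) ?_ (isBag_singleton p) (isBag_singleton t)
        (by simpa using hpK) (by simpa using htK) ⟨?_, z, hz, p, rfl, hzp⟩
        ⟨by simpa using htp.ne', p, rfl, t, rfl, htp.symm⟩
        ⟨by simpa using hat.ne', a', rfl, t, rfl, hat.symm⟩ ?_ ?_
      · rintro w hw rfl; exact haX' hw
      · rintro w hw rfl; exact hpX hw
      · rintro _ rfl; exact ⟨hpa.symm, by rintro _ rfl; exact hap⟩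
      · exact fun w hw => ⟨by rintro rfl; exact htX hw, by rintro _ rfl; exact htz w hw⟩
    · -- `a'` is adjacent to all the other neighbors of `X`, so it is the hub of a wheel
      push Not at hp
      refine absurd ?_ hK4
      have hsa : s ≠ a' := by
        rintro rfl
        exact hnadj (hp s' hs' hsX' hsz' hne.symm)
      have hsa' : s' ≠ a' := by
        rintro rfl
        exact hnadj (hp s hs hsX hsz hne).symm
      exact IsFatCycle.isMinor_of_hub (W := W) (X := X) ⟨hXW, hs, ht, hs', hX, hsX, htX, hsX',
        hsz, hsz', hts, hts', hne, hnadj, htz⟩ haX' ⟨a, haX, h.adj.symm⟩ (hp s hs hsX hsz hsa)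
        hat.symm (hp s' hs' hsX' hsz' hsa')

end Frame

/-! ### Induced cycles -/

section Cycle

variable {V : Type u} {G : SimpleGraph V}

/-- The vertices `c 0, …, c (n - 1)` form, in this cyclic order, an induced cycle of `G`; the values
`c i` for `n ≤ i` are irrelevant. -/
structure IsIndCycle (G : SimpleGraph V) (n : ℕ) (c : ℕ → V) : Prop where
  inj : ∀ i < n, ∀ j < n, c i = c j → i = j
  adj : ∀ i < n, ∀ j < n, G.Adj (c i) (c j) ↔
    (i + 1 = j ∨ j + 1 = i ∨ (i = 0 ∧ j + 1 = n) ∨ (j = 0 ∧ i + 1 = n))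

theorem IsIndCycle.rotate {n : ℕ} {c : ℕ → V} (h : G.IsIndCycle n c) (hn : 3 ≤ n) {k : ℕ}
    (hk : k < n) : ∃ c', G.IsIndCycle n c' ∧ c' '' Set.Iio n = c '' Set.Iio n ∧
      ∀ i < n, c' i = if i + k < n then c (i + k) else c (i + k - n) := by
  refine ⟨fun i => if i + k < n then c (i + k) else c (i + k - n), ⟨?_, ?_⟩, ?_, fun _ _ => rfl⟩
  · intro i hi j hj hij
    split_ifs at hij <;> have := h.inj _ (by omega) _ (by omega) hij <;> omega
  · intro i hi j hj
    split_ifs <;> rw [h.adj _ (by omega) _ (by omega)] <;> omega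
  · ext x
    constructor
    · rintro ⟨i, hi, rfl⟩
      simp only [Set.mem_Iio] at hi
      dsimp only
      split_ifs
      · exact ⟨_, ‹_›, rfl⟩
      · exact ⟨i + k - n, by simp; omega, rfl⟩
    · rintro ⟨i, hi, rfl⟩
      simp only [Set.mem_Iio] at hi
      by_cases hik : k ≤ i
      · refine ⟨i - k, by simp; omega, ?_⟩
        simp [hik, hi]
      · refine ⟨i + n - k, by simp; omega, ?_⟩
        have h1 : ¬ i + n - k + k < n := by omega
        have h2 : i + n - k + k - n = i := by omega
        simp only [h1, h2, if_false]

theorem connOn_image_Icc {c : ℕ → V} {i j : ℕ} (hij : i ≤ j)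
    (h : ∀ k, i ≤ k → k < j → G.Adj (c k) (c (k + 1))) : G.ConnOn (c '' Set.Icc i j) := by
  induction j, hij using Nat.le_induction with
  | base => simpa using connOn_singleton (c i)
  | succ j hj ih =>
    have := (ih fun k hk hk' => h k hk (by omega)).insert_of_adj (x := c j)
      ⟨j, ⟨hj, le_rfl⟩, rfl⟩ (h j hj (by omega))
    rwa [← Set.image_insert_eq, Set.insert_Icc_right_eq_Icc_add_one (by omega)] at this

theorem IsIndCycle.isBag {n : ℕ} {c : ℕ → V} (h : G.IsIndCycle n c) {i j : ℕ} (hij : i ≤ j)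
    (hj : j < n) : G.IsBag (c '' Set.Icc i j) := by
  refine ⟨connOn_image_Icc hij fun k _ hk => ?_, c i, i, ⟨le_rfl, hij⟩, rfl⟩
  exact (h.adj k (by omega) (k + 1) (by omega)).2 (Or.inl rfl)

theorem IsIndCycle.linked {n : ℕ} {c : ℕ → V} (h : G.IsIndCycle n c) {i j k l : ℕ} (hj : j < n)
    (hl : l < n) (hjk : j < k) {p q : ℕ} (hp : i ≤ p ∧ p ≤ j) (hq : k ≤ q ∧ q ≤ l)
    (hpq : p + 1 = q ∨ (p = 0 ∧ q + 1 = n)) :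
    G.Linked (c '' Set.Icc i j) (c '' Set.Icc k l) := by
  refine ⟨?_, c p, ⟨p, hp, rfl⟩, c q, ⟨q, hq, rfl⟩, (h.adj p (by omega) q (by omega)).2 (by omega)⟩
  rintro _ ⟨a, ⟨_, _⟩, rfl⟩ ⟨b, ⟨_, _⟩, hab⟩
  have := h.inj _ (by omega) _ (by omega) hab
  omega

theorem IsIndCycle.apart {n : ℕ} {c : ℕ → V} (h : G.IsIndCycle n c) {i j k l : ℕ} (hj : j < n)
    (hl : l < n) (hjk : j + 1 < k) (hil : 0 < i ∨ l + 1 < n) :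
    G.Apart (c '' Set.Icc i j) (c '' Set.Icc k l) := by
  rintro _ ⟨a, ⟨_, _⟩, rfl⟩
  refine ⟨?_, ?_⟩
  · rintro ⟨b, ⟨_, _⟩, hab⟩
    have := h.inj _ (by omega) _ (by omega) hab
    omega
  · rintro _ ⟨b, ⟨_, _⟩, rfl⟩
    rw [h.adj _ (by omega) _ (by omega)]
    omega

/-- A shortest path from `s` to `s'` through `X` closes up, via `t`, to an induced cycle. -/
theorem IsFatCycle.exists_isIndCycle {W X : Set V} {s t s' : V} (h : G.IsFatCycle W X s t s') :
    ∃ n c, 4 ≤ n ∧ G.IsIndCycle n c := by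
  obtain ⟨x, hx, hxs⟩ := h.adj_left
  obtain ⟨x', hx', hxs'⟩ := h.adj_right
  have hconn : G.ConnOn (insert s' (insert s X)) :=
    (h.conn.insert_of_adj hx hxs).insert_of_adj (Or.inr hx') hxs'
  let G' := G.induce (insert s' (insert s X))
  let a : (insert s' (insert s X) : Set V) := ⟨s, by simp⟩
  let b : (insert s' (insert s X) : Set V) := ⟨s', by simp⟩
  obtain ⟨p, hp⟩ := (connOn_iff_preconnected.1 hconn a b).exists_walk_length_eq_dist
  have hmin : ∀ q : G'.Walk a b, p.length ≤ q.length := fun q => hp ▸ dist_le q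
  -- a shortest walk has no chords and no repeated vertices
  have hadj : ∀ i j, i < j → j ≤ p.length → G'.Adj (p.getVert i) (p.getVert j) → j = i + 1 := by
    intro i j hij hj hadj
    have := hmin ((p.take i).append (.cons hadj (p.drop j)))
    simp only [Walk.length_append, Walk.length_cons, Walk.take_length, Walk.drop_length] at this
    omega
  have hinj : ∀ i j, i < j → j ≤ p.length → p.getVert i ≠ p.getVert j := by
    intro i j hij hj heq
    have := hmin ((p.take i).append ((p.drop j).copy heq.symm rfl))
    simp only [Walk.length_append, Walk.length_copy, Walk.take_length, Walk.drop_length] at this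
    omega
  have hsucc : ∀ i < p.length, G'.Adj (p.getVert i) (p.getVert (i + 1)) := fun i hi =>
    p.adj_getVert_succ hi
  have h0 : (p.getVert 0 : V) = s := by simp [a]
  have hm : (p.getVert p.length : V) = s' := by simp [b]
  have hlen : 2 ≤ p.length := by
    by_contra! hlt
    interval_cases hl : p.length
    · exact h.ne (h0.symm.trans hm)
    · have := hsucc 0 (by omega)
      simp only [G', comap_adj, zero_add, Function.Embedding.subtype_apply] at this
      rw [h0, hm] at this
      exact h.not_adj this
  have ht : ∀ i ≤ p.length, (p.getVert i : V) ≠ t ∧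
      (G.Adj (p.getVert i) t ↔ i = 0 ∨ i = p.length) := by
    intro i hi
    have hmem := (p.getVert i).2
    have key : (p.getVert i : V) ∈ X → i ≠ 0 ∧ i ≠ p.length := by
      refine fun hX => ⟨?_, ?_⟩
      · rintro rfl; rw [h0] at hX; exact h.left_notMem hX
      · rintro rfl; rw [hm] at hX; exact h.right_notMem hX
    rcases hmem with hi' | hi' | hi'
    · have : i = p.length := by
        by_contra hne
        exact hinj i p.length (by omega) le_rfl (Subtype.ext (hi'.trans hm.symm))
      rw [hi']
      exact ⟨h.mid_right.ne', by simp [this, h.mid_right.symm]⟩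
    · have : i = 0 := by
        by_contra hne
        exact hinj 0 i (by omega) hi (Subtype.ext (h0.trans hi'.symm))
      rw [hi']
      exact ⟨h.mid_left.ne', by simp [this, h.mid_left.symm]⟩
    · have := key hi'
      refine ⟨fun h' => h.mid_notMem (h' ▸ hi'), ?_⟩
      simp [h.mid_not_adj _ hi', this.1, this.2]
  refine ⟨p.length + 2, fun i => if i ≤ p.length then (p.getVert i : V) else t, by omega, ?_, ?_⟩
  · intro i hi j hj hij
    split_ifs at hij with h1 h2 h2
    · rcases lt_trichotomy i j with hlt | rfl | hlt
      · exact absurd (Subtype.ext hij) (hinj i j hlt h2)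
      · rfl
      · exact absurd (Subtype.ext hij.symm) (hinj j i hlt h1)
    · exact absurd hij (ht i h1).1
    · exact absurd hij.symm (ht j h2).1
    · omega
  · intro i hi j hj
    have key : ∀ i j, i < j → j ≤ p.length →
        (G.Adj (p.getVert i) (p.getVert j) ↔ i + 1 = j) := by
      intro i j hij hj
      refine ⟨fun h' => (hadj i j hij hj (by simpa [G'] using h')).symm, ?_⟩
      rintro rfl
      simpa [G'] using hsucc i (by omega)
    split_ifs with h1 h2 h2
    · rcases lt_trichotomy i j with hlt | rfl | hlt
      · rw [key i j hlt h2]; omega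
      · simp; omega
      · rw [G.adj_comm, key j i hlt h1]; omega
    · rw [(ht i h1).2]; omega
    · rw [G.adj_comm, (ht j h2).2]; omega
    · simp; omega

theorem IsIndCycle.nonempty_iso {n : ℕ} {c : ℕ → V} (h : G.IsIndCycle n c) (hn : 3 ≤ n)
    (hsurj : ∀ x, ∃ i < n, c i = x) : Nonempty (G ≃g cycleGraph n) := by
  let f : Fin n → V := fun i => c i
  have hf : Function.Bijective f := by
    refine ⟨fun i j hij => Fin.ext (h.inj _ i.2 _ j.2 hij), fun x => ?_⟩
    obtain ⟨i, hi, rfl⟩ := hsurj x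
    exact ⟨⟨i, hi⟩, rfl⟩
  refine ⟨(RelIso.mk (Equiv.ofBijective f hf) ?_ : cycleGraph n ≃g G).symm⟩
  intro i j
  change G.Adj (c i) (c j) ↔ _
  rw [h.adj _ i.2 _ j.2, cycleGraph_adj', Fin.sub_def, Fin.sub_def]
  have := i.2
  have := j.2
  have hmod : ∀ a < n, ∀ b < n, (n - b + a) % n = if b ≤ a then a - b else n - b + a := by
    intro a ha b hb
    split_ifs with hba
    · rw [show n - b + a = (a - b) + n by omega, Nat.add_mod_right, Nat.mod_eq_of_lt (by omega)]
    · exact Nat.mod_eq_of_lt (by omega)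
  simp only [hmod i i.2 j j.2, hmod j j.2 i i.2]
  split_ifs <;> omega

/-- A connected set outside an induced cycle is attached to at most two vertices of the cycle, and
these are consecutive, unless there is a `K₄`-minor or an induced `K_{2,3}`-minor. -/
theorem IsIndCycle.exists_attachment {n : ℕ} {c : ℕ → V} (h : G.IsIndCycle n c) (hn : 4 ≤ n)
    (hK4 : ¬ (completeGraph (Fin 4)).IsMinor G)
    (hK23 : ¬ (completeBipartiteGraph (Fin 2) (Fin 3)).IsInducedMinor G) {K : Set V}
    (hK : G.ConnOn K) (hcK : ∀ x ∈ c '' Set.Iio n, x ∉ K)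
    (hex : ∃ x ∈ c '' Set.Iio n, ∃ y ∈ K, G.Adj x y) :
    ∃ c', G.IsIndCycle n c' ∧ c' '' Set.Iio n = c '' Set.Iio n ∧ (∃ y ∈ K, G.Adj (c' 0) y) ∧
      ∀ j < n, (∃ y ∈ K, G.Adj (c' j) y) → j ≤ 1 := by
  obtain ⟨_, ⟨k, hk, rfl⟩, y, hy, hky⟩ := hex
  obtain ⟨d, hd, himg, hdk⟩ := h.rotate (by omega) hk
  rw [← himg] at hcK ⊢
  have hk' : k < n := hk
  have hd0 : ∃ y ∈ K, G.Adj (d 0) y := ⟨y, hy, by rw [hdk 0 (by omega)]; simpa [hk'] using hky⟩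
  clear hdk himg hky hk hk' h k c
  have hbK : G.IsBag K := ⟨hK, y, hy⟩
  have hdis : ∀ i j, j < n → ∀ x ∈ d '' Set.Icc i j, x ∉ K := by
    rintro i j hj _ ⟨l, ⟨_, _⟩, rfl⟩
    exact hcK _ ⟨l, by simp; omega, rfl⟩
  have hlink : ∀ i j l, j < n → i ≤ l → l ≤ j → (∃ y ∈ K, G.Adj (d l) y) →
      G.Linked (d '' Set.Icc i j) K := fun i j l hj hil hlj ⟨y, hy, hly⟩ =>
    ⟨hdis i j hj, d l, ⟨l, ⟨hil, hlj⟩, rfl⟩, y, hy, hly⟩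
  -- the neighbors of `d 0` on the cycle are the only other possible attachments
  have hfar : ∀ j < n, (∃ y ∈ K, G.Adj (d j) y) → j ≤ 1 ∨ j + 1 = n := by
    intro j hj hdj
    by_contra! hcon
    obtain ⟨h1, h2⟩ := hcon
    by_cases hmid : (∃ i, 1 ≤ i ∧ i ≤ j - 1 ∧ ∃ y ∈ K, G.Adj (d i) y) ∨
        ∃ i, j + 1 ≤ i ∧ i ≤ n - 1 ∧ ∃ y ∈ K, G.Adj (d i) y
    · -- three attachments
      apply hK4
      rcases hmid with ⟨i, hi1, hi2, hdi⟩ | ⟨i, hi1, hi2, hdi⟩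
      · exact isMinor_completeGraph_four (A := d '' Set.Icc 0 0) (B := d '' Set.Icc 1 (j - 1))
          (C := d '' Set.Icc j (n - 1)) (D := K) (hd.isBag le_rfl (by omega))
          (hd.isBag (by omega) (by omega)) (hd.isBag (by omega) (by omega)) hbK
          (hd.linked (p := 0) (q := 1) (by omega) (by omega) (by omega) (by omega) (by omega)
            (by omega))
          (hd.linked (p := 0) (q := n - 1) (by omega) (by omega) (by omega) (by omega) (by omega)
            (by omega))
          (hlink _ _ 0 (by omega) le_rfl le_rfl hd0)
          (hd.linked (p := j - 1) (q := j) (by omega) (by omega) (by omega) (by omega) (by omega)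
            (by omega))
          (hlink _ _ i (by omega) hi1 hi2 hdi) (hlink _ _ j (by omega) le_rfl (by omega) hdj)
      · exact isMinor_completeGraph_four (A := d '' Set.Icc 0 0) (B := d '' Set.Icc 1 j)
          (C := d '' Set.Icc (j + 1) (n - 1)) (D := K) (hd.isBag le_rfl (by omega))
          (hd.isBag (by omega) (by omega)) (hd.isBag (by omega) (by omega)) hbK
          (hd.linked (p := 0) (q := 1) (by omega) (by omega) (by omega) (by omega) (by omega)
            (by omega))
          (hd.linked (p := 0) (q := n - 1) (by omega) (by omega) (by omega) (by omega) (by omega)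
            (by omega))
          (hlink _ _ 0 (by omega) le_rfl le_rfl hd0)
          (hd.linked (p := j) (q := j + 1) (by omega) (by omega) (by omega) (by omega) (by omega)
            (by omega))
          (hlink _ _ j (by omega) (by omega) le_rfl hdj) (hlink _ _ i (by omega) hi1 hi2 hdi)
    · push Not at hmid
      have hap : ∀ i l, l < n → (∀ k, i ≤ k → k ≤ l → ∀ y ∈ K, ¬ G.Adj (d k) y) →
          G.Apart (d '' Set.Icc i l) K := by
        rintro i l hl hk _ ⟨k, hk', rfl⟩
        exact ⟨hdis i l hl _ ⟨k, hk', rfl⟩, hk k hk'.1 hk'.2⟩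
      exact hK23 (isInducedMinor_completeBipartiteGraph (A := d '' Set.Icc 0 0)
        (B := d '' Set.Icc j j) (C := d '' Set.Icc 1 (j - 1)) (D := d '' Set.Icc (j + 1) (n - 1))
        (E := K) (hd.isBag le_rfl (by omega)) (hd.isBag le_rfl (by omega))
        (hd.isBag (by omega) (by omega)) (hd.isBag (by omega) (by omega)) hbK
        (hd.apart (by omega) (by omega) (by omega) (by omega))
        (hd.apart (by omega) (by omega) (by omega) (by omega))
        (hap _ _ (by omega) hmid.1) (hap _ _ (by omega) hmid.2)
        (hd.linked (p := 0) (q := 1) (by omega) (by omega) (by omega) (by omega) (by omega)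
            (by omega))
        (hd.linked (p := 0) (q := n - 1) (by omega) (by omega) (by omega) (by omega) (by omega)
            (by omega))
        (hlink _ _ 0 (by omega) le_rfl le_rfl hd0)
        (by
          obtain ⟨h1, x, hx, y, hy, hxy⟩ := hd.linked (i := 1) (j := j - 1) (k := j) (l := j)
            (p := j - 1) (q := j) (by omega) (by omega) (by omega) (by omega) (by omega) (by omega)
          exact ⟨fun x hx hx' => h1 x hx' hx, y, hy, x, hx, hxy.symm⟩)
        (hd.linked (p := j) (q := j + 1) (by omega) (by omega) (by omega) (by omega) (by omega)
            (by omega))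
        (hlink _ _ j (by omega) le_rfl le_rfl hdj))
  by_cases hlast : ∃ y ∈ K, G.Adj (d (n - 1)) y
  · have hone : ¬ ∃ y ∈ K, G.Adj (d 1) y := fun hd1 => hK4
      (isMinor_completeGraph_four (A := d '' Set.Icc 0 0) (B := d '' Set.Icc 1 (n - 2))
          (C := d '' Set.Icc (n - 1) (n - 1)) (D := K) (hd.isBag le_rfl (by omega))
          (hd.isBag (by omega) (by omega)) (hd.isBag (by omega) (by omega)) hbK
          (hd.linked (p := 0) (q := 1) (by omega) (by omega) (by omega) (by omega) (by omega)
            (by omega))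
          (hd.linked (p := 0) (q := n - 1) (by omega) (by omega) (by omega) (by omega) (by omega)
            (by omega))
          (hlink _ _ 0 (by omega) le_rfl le_rfl hd0)
          (hd.linked (p := n - 2) (q := n - 1) (by omega) (by omega) (by omega) (by omega) (by omega)
            (by omega))
          (hlink _ _ 1 (by omega) le_rfl (by omega) hd1)
          (hlink _ _ (n - 1) (by omega) le_rfl le_rfl hlast))
    obtain ⟨e, he, himg, hek⟩ := hd.rotate (by omega) (k := n - 1) (by omega)
    refine ⟨e, he, himg, ?_, fun j hj hej => ?_⟩
    · rw [hek 0 (by omega), if_pos (by omega)]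
      simpa using hlast
    · by_contra! hj1
      rw [hek j hj, if_neg (by omega)] at hej
      have := hfar _ (by omega) hej
      obtain h3 | h3 : j + (n - 1) - n = 1 ∨ j = n := by omega
      · rw [h3] at hej
        exact hone hej
      · omega
  · refine ⟨d, hd, rfl, hd0, fun j hj hdj => (hfar j hj hdj).resolve_right fun hjn => hlast ?_⟩
    rwa [show n - 1 = j by omega]

/-- A connected graph without simplicial vertices satisfying the excluded minor conditions is a
cycle: Dirac's theorem provides an induced cycle, and a component of the rest would be attached to a
vertex or an edge of that cycle, where it would give rise to a second cycle. -/
theorem exists_iso_cycleGraph [Finite V] (hG : G.Connected)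
    (hK4 : ¬ (completeGraph (Fin 4)).IsMinor G)
    (hK23 : ¬ (completeBipartiteGraph (Fin 2) (Fin 3)).IsInducedMinor G)
    (hF1 : ¬ graphF1.IsInducedMinor G) (hF2 : ¬ graphF2.IsInducedMinor G)
    (hsimp : ∀ v, ¬ G.IsSimplicial v) : ∃ n, 4 ≤ n ∧ Nonempty (G ≃g cycleGraph n) := by
  obtain ⟨X, s, t, s', hX⟩ := exists_isFatCycle (G := G) Set.univ ∅ (by simp)
    ⟨hG.nonempty.some, by simp⟩ (fun w _ _ h => hsimp w (by simpa [IsSimplicial] using h))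
  obtain ⟨n, c, hn, hc⟩ := hX.exists_isIndCycle
  refine ⟨n, hn, hc.nonempty_iso (by omega) ?_⟩
  by_contra! hcon
  obtain ⟨w, hw⟩ := hcon
  have hwC : w ∈ (c '' Set.Iio n)ᶜ := by
    rintro ⟨i, hi, rfl⟩; exact hw i hi rfl
  set K := G.compOn (c '' Set.Iio n)ᶜ w with hKdef
  have hK : G.ConnOn K := connOn_compOn hwC
  have hKC : K ⊆ (c '' Set.Iio n)ᶜ := compOn_subset hwC
  have hcl : ∀ x ∈ K, ∀ y ∉ c '' Set.Iio n, G.Adj x y → y ∈ K := fun x hx y hy hxy =>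
    compOn_closed hx hy hxy
  have hwK : w ∈ K := mem_compOn _ _
  clear_value K
  obtain ⟨x, -, hxK, y, -, hyK, hxy⟩ := (connOn_univ_iff.2 hG.preconnected).exists_adj
    (T := K) (Set.mem_univ w) hwK (Set.mem_univ (c 0))
    (fun h => hKC h ⟨0, by simp; omega, rfl⟩)
  obtain ⟨d, hd, himg, hd0, hd1⟩ := hc.exists_attachment hn hK4 hK23 hK (fun x hx hx' => hKC hx' hx)
    ⟨y, by_contra fun h => hyK (hcl x hxK y h hxy), x, hxK, hxy.symm⟩
  rw [← himg] at hKC hcl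
  have hdK : ∀ i < n, d i ∉ K := fun i hi h => hKC h ⟨i, hi, rfl⟩
  have hframe : G.IsFrame K (d 0) (d 1) (d '' Set.Icc 2 2) (d '' Set.Icc 3 (n - 1)) := by
    refine ⟨fun x hx y hxy => ?_, (hd.adj _ (by omega) _ (by omega)).2 (by omega), hdK _ (by omega),
      hdK _ (by omega), hd.isBag le_rfl (by omega), hd.isBag (by omega) (by omega), ?_, ?_,
      hd.linked (p := 2) (q := 3) (by omega) (by omega) (by omega) (by omega) (by omega) (by omega),
      ?_, ?_⟩
    · by_cases hy : y ∈ d '' Set.Iio n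
      · obtain ⟨j, hj, rfl⟩ := hy
        have hj1 := hd1 j hj ⟨x, hx, hxy.symm⟩
        interval_cases j <;> simp
      · exact Or.inl (hcl x hx y hy hxy)
    · rintro _ ⟨i, ⟨_, _⟩, rfl⟩
      refine ⟨hdK _ (by omega), fun h => ?_, fun h => ?_, ?_⟩
      · have := hd.inj _ (by omega) _ (by omega) h; omega
      · have := hd.inj _ (by omega) _ (by omega) h; omega
      · rw [hd.adj _ (by omega) _ (by omega)]; omega
    · rintro _ ⟨i, ⟨_, _⟩, rfl⟩
      refine ⟨hdK _ (by omega), fun h => ?_, fun h => ?_, ?_⟩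
      · have := hd.inj _ (by omega) _ (by omega) h; omega
      · have := hd.inj _ (by omega) _ (by omega) h; omega
      · rw [hd.adj _ (by omega) _ (by omega)]; omega
    · exact ⟨d 2, ⟨2, by simp, rfl⟩, (hd.adj _ (by omega) _ (by omega)).2 (by omega)⟩
    · exact ⟨d (n - 1), ⟨n - 1, by simp; omega, rfl⟩,
        (hd.adj _ (by omega) _ (by omega)).2 (by omega)⟩
  rcases hframe.isInducedMinor hK4 hK hd0 (fun v _ => hsimp v) with h | h
  · exact hF1 h
  · exact hF2 h

end Cycle

/-! ### Graphs with excluded minors are constructible -/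

section Reduction

variable {V : Type u} {G : SimpleGraph V}

theorem IsMinor.of_induce {W : Type v} {H : SimpleGraph W} {s : Set V}
    (h : H.IsMinor (G.induce s)) : H.IsMinor G := by
  obtain ⟨S, h1, h2, h3⟩ := h
  refine ⟨fun a => Subtype.val '' S a, fun a b hab => ?_, fun a => ?_, fun a b hab => ?_⟩
  · exact Set.disjoint_image_of_injective Subtype.val_injective (h1 hab)
  · have := connected_induce_iff_connOn.1 (h2 a)
    exact connected_induce_iff_connOn.2
      ⟨this.1.image (Embedding.induce s).toHom, this.2.image _⟩
  · obtain ⟨x, hx, y, hy, hxy⟩ := h3 a b hab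
    exact ⟨x, ⟨x, hx, rfl⟩, y, ⟨y, hy, rfl⟩, hxy⟩

theorem IsInducedMinor.of_induce {W : Type v} {H : SimpleGraph W} {s : Set V}
    (h : H.IsInducedMinor (G.induce s)) : H.IsInducedMinor G := by
  obtain ⟨S, h1, h2, h3⟩ := h
  refine ⟨fun a => Subtype.val '' S a, fun a b hab => ?_, fun a => ?_, fun a b hab => ?_⟩
  · exact Set.disjoint_image_of_injective Subtype.val_injective (h1 hab)
  · have := connected_induce_iff_connOn.1 (h2 a)
    exact connected_induce_iff_connOn.2
      ⟨this.1.image (Embedding.induce s).toHom, this.2.image _⟩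
  · rw [h3 a b hab]
    constructor
    · rintro ⟨x, hx, y, hy, hxy⟩
      exact ⟨x, ⟨x, hx, rfl⟩, y, ⟨y, hy, rfl⟩, hxy⟩
    · rintro ⟨_, ⟨x, hx, rfl⟩, _, ⟨y, hy, rfl⟩, hxy⟩
      exact ⟨x, hx, y, hy, hxy⟩

theorem IsSimplicial.ncard_le_two [Finite V] {v : V} (hv : G.IsSimplicial v)
    (hK4 : ¬ (completeGraph (Fin 4)).IsMinor G) : (G.neighborSet v).ncard ≤ 2 := by
  by_contra! h
  obtain ⟨x, hx, y, hy, z, hz, hxy, hxz, hyz⟩ := (Set.two_lt_ncard (Set.toFinite _)).1 h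
  have hl : ∀ a b, G.Adj a b → G.Linked {a} {b} := fun a b hab =>
    ⟨by simpa using hab.ne, a, rfl, b, rfl, hab⟩
  exact hK4 (isMinor_completeGraph_four (isBag_singleton v) (isBag_singleton x) (isBag_singleton y)
    (isBag_singleton z) (hl _ _ hx) (hl _ _ hy) (hl _ _ hz) (hl _ _ (hv hx hy hxy))
    (hl _ _ (hv hx hz hxz)) (hl _ _ (hv hy hz hyz)))

theorem isSimpliciallyConstructible_of_not_isInducedMinor [Finite V] (G : SimpleGraph V)
    (hG : G.Connected) (hK4 : ¬ (completeGraph (Fin 4)).IsMinor G)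
    (hK23 : ¬ (completeBipartiteGraph (Fin 2) (Fin 3)).IsInducedMinor G)
    (hF1 : ¬ graphF1.IsInducedMinor G) (hF2 : ¬ graphF2.IsInducedMinor G) :
    G.IsSimpliciallyConstructible := by
  induction hn : Nat.card V using Nat.strong_induction_on generalizing V with
  | _ n ih =>
  subst hn
  by_cases hsimp : ∃ v, G.IsSimplicial v
  · obtain ⟨v, hv⟩ := hsimp
    have hconn := connOn_univ_iff.2 hG.preconnected
    have hdeg := hv.ncard_le_two hK4
    by_cases h0 : (G.neighborSet v).ncard = 0
    · -- an isolated vertex of a connected graph is the only vertex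
      rw [Set.ncard_eq_zero] at h0
      refine .kOne G ⟨?_⟩
      have hall : ∀ x, x = v := by
        intro x
        by_contra hx
        obtain ⟨a, -, ha, b, -, -, hab⟩ := hconn.exists_adj (T := {v}) (Set.mem_univ v) rfl
          (Set.mem_univ x) hx
        have : b ∈ G.neighborSet v := by rw [← show a = v from ha]; exact hab
        rw [h0] at this
        exact this
      have : Unique V := ⟨⟨v⟩, hall⟩
      exact ⟨Equiv.ofUnique V (Fin 1), by
        intro a b
        simp [Subsingleton.elim a b]⟩
    have hne : ({v}ᶜ : Set V).Nonempty := by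
      obtain ⟨x, hx⟩ := Set.nonempty_of_ncard_ne_zero h0
      exact ⟨x, (show G.Adj v x from hx).ne'⟩
    have hconn' : (G.induce {v}ᶜ).Connected := by
      refine connected_induce_iff_connOn.2 ⟨?_, hne⟩
      rw [Set.compl_eq_univ_sdiff]
      exact hconn.sdiff_singleton_of_isClique (by simpa [IsSimplicial] using hv)
    have hcard : Nat.card ({v}ᶜ : Set V) < Nat.card V := by
      rw [Nat.card_coe_set_eq]
      exact Set.ncard_lt_card (by simp)
    have hrec := ih _ hcard (G.induce {v}ᶜ) hconn' (fun h => hK4 h.of_induce)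
      (fun h => hK23 h.of_induce) (fun h => hF1 h.of_induce) (fun h => hF2 h.of_induce) rfl
    obtain h1 | h2 : (G.neighborSet v).ncard = 1 ∨ (G.neighborSet v).ncard = 2 := by omega
    · exact .attachOne _ G hrec ⟨v, hv, h1, ⟨Iso.refl⟩⟩
    · exact .attachTwo _ G hrec ⟨v, hv, h2, ⟨Iso.refl⟩⟩
  · push Not at hsimp
    obtain ⟨n, hn, h⟩ := exists_iso_cycleGraph hG hK4 hK23 hF1 hF2 hsimp
    exact .cycle G n (by omega) h

end Reduction

/-! ### Blocks as vertex sets -/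

section Blocks

variable {V : Type u} {G : SimpleGraph V}

/-- The vertex set `s` induces a biconnected subgraph of `G`. -/
def IsBiconnOn (G : SimpleGraph V) (s : Set V) : Prop :=
  s.Nonempty ∧ G.ConnOn s ∧ ∀ z, G.ConnOn (s \ {z})

/-- The vertex set of a block: a maximal vertex set inducing a biconnected subgraph. -/
def IsBlockSet (G : SimpleGraph V) (s : Set V) : Prop := Maximal G.IsBiconnOn s

theorem range_embedding_induce (s : Set V) : Set.range (Embedding.induce (G := G) s) = s :=
  Subtype.range_coe

theorem isBiconnOn_image_iff {W : Type v} {H : SimpleGraph W} (f : H ↪g G) {s : Set W} :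
    G.IsBiconnOn (f '' s) ↔ H.IsBiconnOn s := by
  unfold IsBiconnOn
  rw [Set.image_nonempty, connOn_image_iff]
  refine and_congr_right fun _ => and_congr_right fun hs => ⟨fun h z => ?_, fun h z => ?_⟩
  · rw [← connOn_image_iff f, Set.image_sdiff f.injective, Set.image_singleton]
    exact h (f z)
  · by_cases hz : ∃ w, f w = z
    · obtain ⟨w, rfl⟩ := hz
      rw [← Set.image_singleton, ← Set.image_sdiff f.injective, connOn_image_iff]
      exact h w
    · rw [Set.sdiff_singleton_eq_self, connOn_image_iff]
      · exact hs
      · rintro ⟨w, -, hw⟩; exact hz ⟨w, hw⟩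

theorem isBiconnected_iff : G.IsBiconnected ↔ G.IsBiconnOn Set.univ := by
  unfold IsBiconnected IsBiconnOn IsCutVertex
  simp only [not_not, ← connOn_iff_preconnected, connected_iff, connOn_univ_iff,
    Set.compl_eq_univ_sdiff, ← Set.nonempty_iff_univ_nonempty]
  tauto

theorem isBiconnected_induce_iff {s : Set V} :
    (G.induce s).IsBiconnected ↔ G.IsBiconnOn s := by
  rw [isBiconnected_iff, ← isBiconnOn_image_iff (Embedding.induce s), Set.image_univ,
    range_embedding_induce]

theorem IsBiconnOn.mono {G' : SimpleGraph V} (h : G ≤ G') {s : Set V} (hs : G.IsBiconnOn s) :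
    G'.IsBiconnOn s := ⟨hs.1, hs.2.1.mono h, fun z => (hs.2.2 z).mono h⟩

/-- Blocks are induced subgraphs. -/
theorem isBlock_iff {B : G.Subgraph} :
    G.IsBlock B ↔ ∃ s, G.IsBlockSet s ∧ B = (⊤ : G.Subgraph).induce s := by
  have hverts : ∀ H : G.Subgraph, H.coe.IsBiconnected → G.IsBiconnOn H.verts := by
    intro H hH
    rw [← isBiconnected_induce_iff]
    rw [isBiconnected_iff] at hH ⊢
    exact hH.mono (show H.coe ≤ G.induce H.verts from fun a b hab => H.adj_sub hab)
  have hind : ∀ s, ((⊤ : G.Subgraph).induce s).coe.IsBiconnected ↔ G.IsBiconnOn s := by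
    intro s
    rw [← isBiconnected_induce_iff, induce_eq_coe_induce_top]
    rfl
  have hle : ∀ (H : G.Subgraph) (s : Set V), H.verts ⊆ s → H ≤ (⊤ : G.Subgraph).induce s :=
    fun H s hs => ⟨hs, fun a b hab => ⟨hs (H.edge_vert hab), hs (H.edge_vert hab.symm),
      H.adj_sub hab⟩⟩
  constructor
  · rintro ⟨hB, hmax⟩
    refine ⟨B.verts, ⟨hverts B hB, fun t ht hBt => ?_⟩, ?_⟩
    · exact (hmax ((hind t).2 ht) (hle B t hBt)).1
    · exact le_antisymm (hle B _ subset_rfl)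
        (hmax ((hind _).2 (hverts B hB)) (hle B _ subset_rfl))
  · rintro ⟨s, ⟨hs, hmax⟩, rfl⟩
    exact ⟨(hind s).2 hs, fun H hH hsH => hle H s (hmax (hverts H hH) hsH.1)⟩

theorem IsBiconnOn.exists_isBlockSet [Finite V] {s : Set V} (hs : G.IsBiconnOn s) :
    ∃ t, s ⊆ t ∧ G.IsBlockSet t :=
  (Set.toFinite {t | G.IsBiconnOn t}).exists_le_maximal hs

theorem isBiconnOn_singleton (x : V) : G.IsBiconnOn {x} := by
  refine ⟨⟨x, rfl⟩, connOn_singleton x, fun z => ?_⟩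
  rcases Set.subset_singleton_iff_eq.1 (Set.sdiff_subset (s := {x}) (t := {z})) with h | h
  · rw [h]; exact connOn_empty
  · rw [h]; exact connOn_singleton x

theorem isBiconnOn_pair {x y : V} (h : G.Adj x y) : G.IsBiconnOn {x, y} := by
  refine ⟨⟨x, by simp⟩, connOn_pair h, fun z => ?_⟩
  by_cases hx : z = x
  · subst hx
    rw [Set.insert_sdiff_self_of_notMem (by simpa using h.ne)]
    exact connOn_singleton y
  by_cases hy : z = y
  · subst hy
    rw [Set.pair_comm, Set.insert_sdiff_self_of_notMem (by simpa using h.ne')]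
    exact connOn_singleton x
  · rw [Set.sdiff_singleton_eq_self (by simp [hx, hy])]
    exact connOn_pair h

theorem IsBiconnOn.insert {s : Set V} (hs : G.IsBiconnOn s) {v x y : V} (hx : x ∈ s) (hy : y ∈ s)
    (hxy : x ≠ y) (hvx : G.Adj v x) (hvy : G.Adj v y) : G.IsBiconnOn (insert v s) := by
  refine ⟨⟨x, Or.inr hx⟩, hs.2.1.insert_of_adj hx hvx.symm, fun z => ?_⟩
  by_cases hvz : v = z
  · subst hvz
    rw [Set.insert_sdiff_of_mem _ (Set.mem_singleton v)]
    exact hs.2.2 v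
  · rw [Set.insert_sdiff_of_notMem _ (by simpa using hvz)]
    by_cases hxz : x = z
    · exact (hs.2.2 z).insert_of_adj (x := y) ⟨hy, fun h => hxy (hxz.trans h.symm)⟩ hvy.symm
    · exact (hs.2.2 z).insert_of_adj (x := x) ⟨hx, hxz⟩ hvx.symm

/-- A connected set outside a block is attached to at most one vertex of the block. Otherwise, a
smallest such set could be added to the block. -/
theorem IsBlockSet.eq_of_adj [Finite V] {B : Set V} (hB : G.IsBlockSet B) {K : Set V}
    (hK : G.ConnOn K) (hKB : ∀ x ∈ K, x ∉ B) {p q : V} (hp : p ∈ B) (hq : q ∈ B)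
    (hpK : ∃ x ∈ K, G.Adj p x) (hqK : ∃ x ∈ K, G.Adj q x) : p = q := by
  by_contra hpq
  obtain ⟨K, ⟨hK, hKB, hpK, hqK⟩, hmin⟩ := Set.exists_min_image
    {K : Set V | G.ConnOn K ∧ (∀ x ∈ K, x ∉ B) ∧ (∃ x ∈ K, G.Adj p x) ∧ ∃ x ∈ K, G.Adj q x}
    Set.ncard (Set.toFinite _) ⟨K, hK, hKB, hpK, hqK⟩
  obtain ⟨x, hx, hpx⟩ := hpK
  obtain ⟨y, hy, hqy⟩ := hqK
  obtain ⟨⟨-, hBc, hBz⟩, hmax⟩ := hB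
  refine hKB x hx (hmax (y := B ∪ K) ⟨⟨p, Or.inl hp⟩, hBc.union_of_adj hK hp hx hpx, fun z => ?_⟩
    Set.subset_union_left (Or.inr hx))
  rw [Set.union_sdiff_distrib]
  by_cases hzK : z ∈ K
  · have hzB := hKB z hzK
    rw [Set.sdiff_singleton_eq_self hzB]
    -- `R` is the component of `B` in `(B ∪ K) \ {z}`
    set R := G.compOn (B ∪ K \ {z}) p with hR
    have hpU : p ∈ B ∪ K \ {z} := Or.inl hp
    have hBR : B ⊆ R := hBc.subset_of_closed hp (mem_compOn _ _)
      (fun a ha _ b hb hab => compOn_closed ha (Or.inl hb) hab)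
    suffices hKR : K \ {z} ⊆ R by
      rw [show B ∪ K \ {z} = R from
        Set.Subset.antisymm (Set.union_subset hBR hKR) (compOn_subset hpU)]
      exact connOn_compOn hpU
    -- the vertices of `K` other than `z` outside `R` could be removed from `K`, so there are none
    have hcl : ∀ a ∈ R, ∀ b ∈ K, b ≠ z → G.Adj a b → b ∈ R := fun a ha b hb hbz hab =>
      compOn_closed ha (Or.inr ⟨hb, hbz⟩) hab
    have hmem : ∀ r ∈ B, ∀ a ∈ K, G.Adj r a → a ∈ K ∧ (a = z ∨ a ∈ R) := fun r hr a ha hra =>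
      ⟨ha, or_iff_not_imp_left.2 fun haz => hcl r (hBR hr) a ha haz hra⟩
    have hle := hmin {a | a ∈ K ∧ (a = z ∨ a ∈ R)} ⟨?_, fun a ha => hKB a ha.1,
      ⟨x, hmem p hp x hx hpx, hpx⟩, y, hmem q hq y hy hqy, hqy⟩
    · have heq := Set.eq_of_subset_of_ncard_le (s := {a | a ∈ K ∧ (a = z ∨ a ∈ R)}) (t := K)
        (fun a ha => ha.1) hle (Set.toFinite _)
      intro a ha
      have haK : a ∈ K := ha.1
      rw [← heq] at haK
      exact haK.2.resolve_left ha.2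
    · refine connOn_of_root z (fun T hT hzT hclT a ha => ?_) ⟨hzK, Or.inl rfl⟩
      have := hK.subset_of_closed (T := T ∪ {b | b ≠ z ∧ b ∉ R}) hzK (Or.inl hzT) (by
        intro b hb hbK d hdK hbd
        by_cases hdz : d = z
        · exact Or.inl (hdz ▸ hzT)
        by_cases hdR : d ∈ R
        · rcases hb with hb | hb
          · exact Or.inl (hclT b hb d ⟨hdK, Or.inr hdR⟩ hbd)
          · exact absurd (hcl d hdR b hbK hb.1 hbd.symm) hb.2
        · exact Or.inr ⟨hdz, hdR⟩)
      rcases this ha.1 with h | h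
      · exact h
      · exact absurd ha.2 (by rintro (h' | h'); exacts [h.1 h', h.2 h'])
  · rw [Set.sdiff_singleton_eq_self hzK]
    by_cases hpz : p = z
    · exact (hBz z).union_of_adj hK (x := q) ⟨hq, fun h => hpq (hpz.trans h.symm)⟩ hy hqy
    · exact (hBz z).union_of_adj hK (x := p) ⟨hp, hpz⟩ hx hpx

end Blocks

/-! ### Simplicial extensions -/

section Extension

theorem nonempty_iso_of_range_eq {V : Type u} {A : Type v} {B : Type w} {G : SimpleGraph V}
    {HA : SimpleGraph A} {HB : SimpleGraph B} (f : HA ↪g G) (g : HB ↪g G)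
    (h : Set.range f = Set.range g) : Nonempty (HA ≃g HB) := by
  let e : A ≃ B := (Equiv.ofInjective f f.injective).trans
    ((Equiv.setCongr h).trans (Equiv.ofInjective g g.injective).symm)
  have he : ∀ a, g (e a) = f a := fun a => by
    simp [e, Equiv.apply_ofInjective_symm]
  exact ⟨⟨e, fun {a b} => by rw [← g.map_adj_iff, he, he, f.map_adj_iff]⟩⟩

/-- A copy of `H` in `G` together with a new vertex `v` is a simplicial extension of `H`, if the
neighbors of `v` in this copy form a clique with `d` vertices. -/
theorem isSimplicialExtension_induce {V : Type u} {W : Type v} {G : SimpleGraph V}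
    {H : SimpleGraph W} (f : H ↪g G) {s : Set V} {v : V} (hvs : v ∈ s)
    (hs : Set.range f = s \ {v}) {d : ℕ} (hcl : G.IsClique (s ∩ G.neighborSet v))
    (hd : (s ∩ G.neighborSet v).ncard = d) : IsSimplicialExtension d H (G.induce s) := by
  refine ⟨⟨v, hvs⟩, fun x hx y hy hxy => ?_, ?_, ?_⟩
  · exact hcl ⟨x.2, hx⟩ ⟨y.2, hy⟩ (fun h => hxy (Subtype.ext h))
  · rw [← hd, ← Set.ncard_image_of_injective _ Subtype.val_injective]
    congr 1
    ext x
    constructor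
    · rintro ⟨y, hy, rfl⟩; exact ⟨y.2, hy⟩
    · rintro ⟨hx, hx'⟩; exact ⟨⟨x, hx⟩, hx', rfl⟩
  · refine nonempty_iso_of_range_eq
      ((Embedding.induce s).comp (Embedding.induce (G := G.induce s) {⟨v, hvs⟩}ᶜ)) f ?_
    rw [hs]
    ext x
    constructor
    · rintro ⟨⟨y, hy⟩, rfl⟩
      exact ⟨y.2, fun h => hy (Subtype.ext h)⟩
    · rintro ⟨hx, hxv⟩
      exact ⟨⟨⟨x, hx⟩, fun h => hxv (congrArg Subtype.val h)⟩, rfl⟩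

theorem IsSimplicialExtension.of_iso {V : Type u} {V' : Type v} {W : Type w} {G : SimpleGraph V}
    {G' : SimpleGraph V'} {H : SimpleGraph W} {d : ℕ} (h : IsSimplicialExtension d H G)
    (e : G ≃g G') : IsSimplicialExtension d H G' := by
  obtain ⟨v, hv, hd, ⟨i⟩⟩ := h
  have hN : G'.neighborSet (e v) = e '' G.neighborSet v := by
    ext x
    constructor
    · intro hx
      refine ⟨e.symm x, e.map_adj_iff.1 ?_, e.apply_symm_apply x⟩
      rw [e.apply_symm_apply]
      exact hx
    · rintro ⟨y, hy, rfl⟩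
      exact e.map_adj_iff.2 hy
  refine ⟨e v, ?_, ?_, ?_⟩
  · rw [IsSimplicial, hN]
    rintro _ ⟨x, hx, rfl⟩ _ ⟨y, hy, rfl⟩ hxy
    exact e.map_adj_iff.2 (hv hx hy (fun h => hxy (by rw [h])))
  · rw [hN, Set.ncard_image_of_injective _ e.injective, hd]
  · obtain ⟨j⟩ := nonempty_iso_of_range_eq (Embedding.induce (G := G') {e v}ᶜ)
      (e.toEmbedding.comp (Embedding.induce (G := G) {v}ᶜ)) (by
        ext x
        simp only [Embedding.induce, Set.mem_range]
        constructor
        · rintro ⟨⟨y, hy⟩, rfl⟩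
          refine ⟨⟨e.symm y, fun h => hy ?_⟩, ?_⟩
          · change y = e v
            rw [← show e.symm y = v from h, e.apply_symm_apply]
          · exact e.apply_symm_apply y
        · rintro ⟨⟨y, hy⟩, rfl⟩
          exact ⟨⟨e y, fun h => hy (e.injective h)⟩, rfl⟩)
    exact ⟨j.trans i⟩

theorem IsTwoTree.of_iso {V V' : Type u} {G : SimpleGraph V} {G' : SimpleGraph V'}
    (h : G.IsTwoTree) (e : G ≃g G') : G'.IsTwoTree := by
  cases h with
  | base _ h => exact .base _ (h.map fun i => e.symm.trans i)
  | step H _ h h' => exact .step H _ h (h'.of_iso e)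

theorem IsHollowedTwoTree.of_iso {V V' : Type u} {G : SimpleGraph V} {G' : SimpleGraph V'}
    (h : G.IsHollowedTwoTree) (e : G ≃g G') : G'.IsHollowedTwoTree := by
  cases h with
  | base _ n hn h => exact .base _ n hn (h.map fun i => e.symm.trans i)
  | step H _ h h' => exact .step H _ h (h'.of_iso e)

theorem IsSimpliciallyConstructible.of_iso {V V' : Type u} {G : SimpleGraph V}
    {G' : SimpleGraph V'} (h : G.IsSimpliciallyConstructible) (e : G ≃g G') :
    G'.IsSimpliciallyConstructible := by
  cases h with
  | kOne _ h => exact .kOne _ (h.map fun i => e.symm.trans i)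
  | cycle _ n hn h => exact .cycle _ n hn (h.map fun i => e.symm.trans i)
  | attachOne H _ h h' => exact .attachOne H _ h (h'.of_iso e)
  | attachTwo H _ h h' => exact .attachTwo H _ h (h'.of_iso e)

theorem IsHollowedTwoTree.isSimpliciallyConstructible {V : Type u} {G : SimpleGraph V}
    (h : G.IsHollowedTwoTree) : G.IsSimpliciallyConstructible := by
  induction h with
  | base G n hn h => exact .cycle G n (by omega) h
  | step H G _ h ih => exact .attachTwo H G ih h

theorem isTwoTree_induce_pair {V : Type u} {G : SimpleGraph V} {x y : V} (h : G.Adj x y) :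
    (G.induce {x, y}).IsTwoTree := by
  refine .base _ (nonempty_iso_of_range_eq (Embedding.induce _)
    (⟨⟨![x, y], ?_⟩, fun {i j} => ?_⟩ : completeGraph (Fin 2) ↪g G) ?_)
  · intro i j
    fin_cases i <;> fin_cases j <;> simp [h.ne, h.ne']
  · change G.Adj (![x, y] i) (![x, y] j) ↔ i ≠ j
    fin_cases i <;> fin_cases j <;> simp [h, h.symm]
  · rw [range_embedding_induce]
    exact (Matrix.range_cons_cons_empty x y ![]).symm

theorem isTwoTree_of_iso_cycleGraph_three {V : Type u} {G : SimpleGraph V}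
    (e : G ≃g cycleGraph 3) : G.IsTwoTree := by
  have hadj : ∀ i j, i ≠ j → G.Adj (e.symm i) (e.symm j) := by
    intro i j hij
    rw [e.symm.map_adj_iff, cycleGraph_three_eq_top]
    exact hij
  have h0 : ∀ x, x = e.symm 0 ∨ x = e.symm 1 ∨ x = e.symm 2 := by
    intro x
    obtain ⟨i, rfl⟩ := e.symm.surjective x
    fin_cases i <;> simp
  have huniv : insert (e.symm 0) {e.symm 1, e.symm 2} = Set.univ :=
    Set.eq_univ_of_forall fun x => by simpa using h0 x
  have hne1 := (hadj 0 1 (by decide)).ne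
  have hne2 := (hadj 0 2 (by decide)).ne
  have hN : Set.univ ∩ G.neighborSet (e.symm 0) = {e.symm 1, e.symm 2} := by
    ext x
    simp only [Set.univ_inter, mem_neighborSet, Set.mem_insert_iff, Set.mem_singleton_iff]
    refine ⟨fun h => (h0 x).resolve_left h.ne', ?_⟩
    rintro (rfl | rfl)
    exacts [hadj _ _ (by decide), hadj _ _ (by decide)]
  refine IsTwoTree.of_iso (.step _ _ (isTwoTree_induce_pair (hadj 1 2 (by decide)))
    (isSimplicialExtension_induce (s := Set.univ) (v := e.symm 0) (Embedding.induce _)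
      (Set.mem_univ _) ?_ ?_ ?_)) (induceUnivIso G)
  · rw [← huniv, Set.insert_sdiff_self_of_notMem (by simp [hne1, hne2])]
    simp [Embedding.induce]
  · rw [hN]
    exact isClique_pair.2 fun _ => hadj _ _ (by decide)
  · rw [hN, Set.ncard_pair (hadj _ _ (by decide)).ne]

end Extension

/-! ### The blocks of constructible graphs -/

section ConstructibleBlocks

/-- The condition on the blocks, for blocks viewed as vertex sets. -/
def HasTwoTreeBlocks {V : Type u} (G : SimpleGraph V) : Prop :=
  (∀ s, G.IsBlockSet s →
    (G.induce s).IsTwoTree ∨ (G.induce s).IsKOne ∨ (G.induce s).IsHollowedTwoTree) ∧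
  ∀ s s', G.IsBlockSet s → G.IsBlockSet s' → ¬ (G.induce s).IsTwoTree →
    ¬ (G.induce s').IsTwoTree → s = s'

theorem hasTwoTreeBlocks_iff {V : Type u} {G : SimpleGraph V} : G.HasTwoTreeBlocks ↔
    (∀ B : G.Subgraph, G.IsBlock B →
      B.coe.IsTwoTree ∨ B.coe.IsKOne ∨ B.coe.IsHollowedTwoTree) ∧
    ∀ B B' : G.Subgraph, G.IsBlock B → G.IsBlock B' →
      ¬ B.coe.IsTwoTree → ¬ B'.coe.IsTwoTree → B = B' := by
  constructor
  · rintro ⟨h1, h2⟩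
    refine ⟨fun B hB => ?_, fun B B' hB hB' => ?_⟩
    · obtain ⟨s, hs, rfl⟩ := isBlock_iff.1 hB
      rw [← induce_eq_coe_induce_top]
      exact h1 s hs
    · obtain ⟨s, hs, rfl⟩ := isBlock_iff.1 hB
      obtain ⟨s', hs', rfl⟩ := isBlock_iff.1 hB'
      rw [← induce_eq_coe_induce_top, ← induce_eq_coe_induce_top]
      exact fun h h' => by rw [h2 s s' hs hs' h h']
  · rintro ⟨h1, h2⟩
    refine ⟨fun s hs => ?_, fun s s' hs hs' h h' => ?_⟩
    · have := h1 _ (isBlock_iff.2 ⟨s, hs, rfl⟩)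
      rwa [← induce_eq_coe_induce_top] at this
    · have := h2 _ _ (isBlock_iff.2 ⟨s, hs, rfl⟩) (isBlock_iff.2 ⟨s', hs', rfl⟩)
      rw [← induce_eq_coe_induce_top, ← induce_eq_coe_induce_top] at this
      exact congrArg Subgraph.verts (this h h')

theorem hasTwoTreeBlocks_of_isBiconnOn_univ {V : Type u} {G : SimpleGraph V}
    (h : G.IsBiconnOn Set.univ) (hG : G.IsTwoTree ∨ G.IsKOne ∨ G.IsHollowedTwoTree) :
    G.HasTwoTreeBlocks := by
  have huniv : ∀ s, G.IsBlockSet s → s = Set.univ := fun s hs =>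
    Set.eq_univ_of_univ_subset (hs.2 h (Set.subset_univ s))
  refine ⟨fun s hs => ?_, fun s s' hs hs' _ _ => (huniv s hs).trans (huniv s' hs').symm⟩
  rw [huniv s hs]
  rcases hG with h | h | h
  · exact Or.inl (h.of_iso (induceUnivIso G).symm)
  · exact Or.inr (Or.inl (h.map fun i => (induceUnivIso G).trans i))
  · exact Or.inr (Or.inr (h.of_iso (induceUnivIso G).symm))

theorem isBiconnOn_univ_cycleGraph (n : ℕ) : (cycleGraph (n + 2)).IsBiconnOn Set.univ := by
  refine ⟨Set.univ_nonempty, connOn_univ_iff.2 cycleGraph_preconnected, fun z => ?_⟩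
  have h1 : ∀ k (hk : k + 1 < n + 2), z + ⟨k + 1, hk⟩ ∈ Set.univ \ {z} := by
    intro k hk
    refine ⟨Set.mem_univ _, fun h => ?_⟩
    simp at h
  refine connOn_of_root (z + ⟨0 + 1, by omega⟩) (fun T _ h0 hcl y hy => ?_) (h1 0 (by omega))
  have key : ∀ k (hk : k + 1 < n + 2), z + ⟨k + 1, hk⟩ ∈ T := by
    intro k hk
    induction k with
    | zero => exact h0
    | succ k ih =>
      refine hcl _ (ih (by omega)) _ (h1 _ hk) ?_
      rw [cycleGraph_adj]
      right
      rw [add_sub_add_left_eq_sub, sub_eq_iff_eq_add]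
      refine Fin.ext ?_
      rw [Fin.val_add, Fin.val_one, Nat.mod_eq_of_lt] <;> dsimp only <;> omega
  have hyz : (y - z).val ≠ 0 := by
    rw [Ne, Fin.val_eq_zero_iff, sub_eq_zero]
    exact hy.2
  have hlt := (y - z).isLt
  have := key ((y - z).val - 1) (by omega)
  rwa [show (⟨(y - z).val - 1 + 1, by omega⟩ : Fin (n + 2)) = y - z from
    Fin.ext (Nat.sub_add_cancel (by omega)), add_sub_cancel] at this

section Attach

variable {V W : Type u} {G : SimpleGraph V} {H : SimpleGraph W} (f : H ↪g G) {v : V}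

theorem isBlockSet_preimage (hf : Set.range f = {v}ᶜ) {s : Set V} (hs : G.IsBlockSet s)
    (hvs : v ∉ s) : H.IsBlockSet (f ⁻¹' s) := by
  have him : f '' (f ⁻¹' s) = s := by
    rw [Set.image_preimage_eq_iff, hf]
    exact fun x hx h => hvs (h ▸ hx)
  refine ⟨(isBiconnOn_image_iff f).1 (him.symm ▸ hs.1), fun t ht hst => ?_⟩
  rw [← Set.image_subset_iff]
  exact hs.2 ((isBiconnOn_image_iff f).2 ht) (him ▸ Set.image_mono hst)

theorem nonempty_iso_induce_preimage (hf : Set.range f = {v}ᶜ) {s : Set V} (hvs : v ∉ s) :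
    Nonempty (H.induce (f ⁻¹' s) ≃g G.induce s) := by
  refine nonempty_iso_of_range_eq (f.comp (Embedding.induce _)) (Embedding.induce s) ?_
  have him : f '' (f ⁻¹' s) = s := by
    rw [Set.image_preimage_eq_iff, hf]
    exact fun x hx h => hvs (h ▸ hx)
  rw [range_embedding_induce]
  refine Eq.trans ?_ him
  ext x
  simp [Embedding.induce]

theorem isBlockSet_eq_of_degree_one {u : V} (hN : G.neighborSet v = {u}) {s : Set V}
    (hs : G.IsBlockSet s) (hvs : v ∈ s) : s = {v, u} := by
  have hvu : G.Adj v u := by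
    have : u ∈ G.neighborSet v := by rw [hN]; rfl
    exact this
  have hsub : s ⊆ {v, u} := by
    intro w hw
    by_contra hwvu
    simp only [Set.mem_insert_iff, Set.mem_singleton_iff, not_or] at hwvu
    -- `u` would separate `v` from `w`
    obtain ⟨a, -, ha, b, hb, -, hab⟩ := (hs.1.2.2 u).exists_adj (T := {v}) (x := v) (y := w)
      ⟨hvs, hvu.ne⟩ rfl ⟨hw, hwvu.2⟩ hwvu.1
    have : b ∈ G.neighborSet v := by rw [← show a = v from ha]; exact hab
    rw [hN] at this
    exact hb.2 this
  exact Set.Subset.antisymm hsub (hs.2 (isBiconnOn_pair hvu) hsub)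

/-- A block containing the simplicial vertex `v` of degree 2 is a simplicial extension of a block of
the remaining graph. -/
theorem isBlockSet_of_degree_two (hf : Set.range f = {v}ᶜ) {x y : V} (hxy : G.Adj x y)
    (hN : G.neighborSet v = {x, y}) {s : Set V} (hs : G.IsBlockSet s) (hvs : v ∈ s) :
    x ∈ s ∧ y ∈ s ∧ H.IsBlockSet (f ⁻¹' s) ∧
      IsSimplicialExtension 2 (H.induce (f ⁻¹' s)) (G.induce s) := by
  have hadj : ∀ z, G.Adj v z ↔ z = x ∨ z = y := by
    intro z
    rw [← mem_neighborSet, hN]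
    simp
  have hvx := (hadj x).2 (Or.inl rfl)
  have hvy := (hadj y).2 (Or.inr rfl)
  have htri : G.IsBiconnOn {v, x, y} :=
    (isBiconnOn_pair hxy).insert (x := x) (y := y) (by simp) (by simp) hxy.ne hvx hvy
  -- a block contains with `v` one of its neighbors, and then the other one, too
  have hxys : x ∈ s ∧ y ∈ s := by
    by_contra hcon
    have : s ⊆ {v, x, y} := by
      intro w hw
      by_contra hwn
      simp only [Set.mem_insert_iff, Set.mem_singleton_iff, not_or] at hwn
      rw [not_and_or] at hcon
      rcases hcon with hc | hc
      · obtain ⟨a, -, ha, b, hb, -, hab⟩ := (hs.1.2.2 y).exists_adj (T := {v}) (x := v) (y := w)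
          ⟨hvs, hvy.ne⟩ rfl ⟨hw, hwn.2.2⟩ hwn.1
        rw [show a = v from ha, hadj] at hab
        rcases hab with rfl | rfl
        exacts [hc hb.1, hb.2 rfl]
      · obtain ⟨a, -, ha, b, hb, -, hab⟩ := (hs.1.2.2 x).exists_adj (T := {v}) (x := v) (y := w)
          ⟨hvs, hvx.ne⟩ rfl ⟨hw, hwn.2.1⟩ hwn.1
        rw [show a = v from ha, hadj] at hab
        rcases hab with rfl | rfl
        exacts [hb.2 rfl, hc hb.1]
    have hle := hs.2 htri this
    exact hcon ⟨hle (by simp), hle (by simp)⟩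
  obtain ⟨hxs, hys⟩ := hxys
  have hsN : s ∩ G.neighborSet v = {x, y} := by
    rw [hN, Set.inter_eq_right]
    rintro z (rfl | rfl) <;> assumption
  have him : f '' (f ⁻¹' s) = s \ {v} := by
    rw [Set.image_preimage_eq_inter_range, hf]
    rfl
  refine ⟨hxs, hys, ⟨(isBiconnOn_image_iff f).1 ?_, fun t ht hst => ?_⟩, ?_⟩
  · rw [him]
    have hcl : ∀ z, G.IsClique ((s \ {z}) ∩ G.neighborSet v) := fun z =>
      (hsN ▸ isClique_pair.2 fun _ => hxy : G.IsClique (s ∩ G.neighborSet v)).subset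
        (Set.inter_subset_inter_left _ Set.sdiff_subset)
    refine ⟨⟨x, hxs, hvx.ne'⟩, hs.1.2.2 v, fun z => ?_⟩
    rw [sdiff_sdiff_comm]
    exact (hs.1.2.2 z).sdiff_singleton_of_isClique (hcl z)
  · have hft : s \ {v} ⊆ f '' t := him ▸ Set.image_mono hst
    have := hs.2 (((isBiconnOn_image_iff f).2 ht).insert (hft ⟨hxs, hvx.ne'⟩)
      (hft ⟨hys, hvy.ne'⟩) hxy.ne hvx hvy) (fun z hz => ?_)
    · exact fun z hz => this (Or.inr ⟨z, hz, rfl⟩)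
    · by_cases hzv : z = v
      · exact Or.inl hzv
      · exact Or.inr (hft ⟨hz, hzv⟩)
  · refine isSimplicialExtension_induce (f.comp (Embedding.induce (f ⁻¹' s))) hvs ?_ ?_ ?_
    · rw [← him]
      ext z
      simp [Embedding.induce]
    · rw [hsN]
      exact isClique_pair.2 fun _ => hxy
    · rw [hsN, Set.ncard_pair hxy.ne]

theorem exists_embedding_of_iso (e : G.induce {v}ᶜ ≃g H) :
    ∃ f : H ↪g G, Set.range f = {v}ᶜ := by
  refine ⟨(Embedding.induce {v}ᶜ).comp e.symm.toEmbedding, ?_⟩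
  ext x
  constructor
  · rintro ⟨y, rfl⟩
    exact (e.symm y).2
  · intro hx
    exact ⟨e ⟨x, hx⟩, by simp [Embedding.induce]⟩

end Attach

theorem IsSimpliciallyConstructible.hasTwoTreeBlocks {V : Type u} {G : SimpleGraph V}
    (h : G.IsSimpliciallyConstructible) : G.HasTwoTreeBlocks := by
  induction h with
  | kOne G h =>
    obtain ⟨e⟩ := h
    refine hasTwoTreeBlocks_of_isBiconnOn_univ ?_ (Or.inr (Or.inl ⟨e⟩))
    rw [show Set.univ = {e.symm 0} from Set.eq_singleton_iff_unique_mem.2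
      ⟨Set.mem_univ _, fun x _ => e.injective (Subsingleton.elim _ _)⟩]
    exact isBiconnOn_singleton _
  | cycle G n hn h =>
    obtain ⟨e⟩ := h
    obtain ⟨m, rfl⟩ := Nat.exists_eq_add_of_le' (by omega : 2 ≤ n)
    refine hasTwoTreeBlocks_of_isBiconnOn_univ ?_ ?_
    · rw [← isBiconnOn_image_iff e.toEmbedding]
      convert isBiconnOn_univ_cycleGraph m
      exact Set.image_univ_of_surjective e.surjective
    · by_cases hm : m = 1
      · subst hm
        exact Or.inl (isTwoTree_of_iso_cycleGraph_three e)
      · exact Or.inr (Or.inr (.base G _ (by omega) ⟨e⟩))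
  | attachOne H G _ h ih =>
    obtain ⟨v, -, hd, ⟨e⟩⟩ := h
    obtain ⟨u, hN⟩ := Set.ncard_eq_one.1 hd
    obtain ⟨f, hf⟩ := exists_embedding_of_iso e
    have hvu : G.Adj v u := by
      have : u ∈ G.neighborSet v := by rw [hN]; rfl
      exact this
    have htt : ∀ s, G.IsBlockSet s → v ∈ s → (G.induce s).IsTwoTree := by
      intro s hs hvs
      rw [isBlockSet_eq_of_degree_one hN hs hvs]
      exact isTwoTree_induce_pair hvu
    refine ⟨fun s hs => ?_, fun s s' hs hs' hn hn' => ?_⟩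
    · by_cases hvs : v ∈ s
      · exact Or.inl (htt s hs hvs)
      · obtain ⟨i⟩ := nonempty_iso_induce_preimage f hf hvs
        exact (ih.1 _ (isBlockSet_preimage f hf hs hvs)).imp (fun h => h.of_iso i)
          (Or.imp (fun h => h.map fun j => i.symm.trans j) (fun h => h.of_iso i))
    · have hvs : v ∉ s := fun h => hn (htt s hs h)
      have hvs' : v ∉ s' := fun h => hn' (htt s' hs' h)
      obtain ⟨i⟩ := nonempty_iso_induce_preimage f hf hvs
      obtain ⟨i'⟩ := nonempty_iso_induce_preimage f hf hvs'
      have := ih.2 _ _ (isBlockSet_preimage f hf hs hvs) (isBlockSet_preimage f hf hs' hvs')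
        (fun h => hn (h.of_iso i)) (fun h => hn' (h.of_iso i'))
      refine (Set.preimage_eq_preimage' ?_ ?_).1 this <;> rw [hf]
      · exact fun x hx h => hvs (h ▸ hx)
      · exact fun x hx h => hvs' (h ▸ hx)
  | attachTwo H G _ h ih =>
    obtain ⟨v, hv, hd, ⟨e⟩⟩ := h
    obtain ⟨x, y, hxy, hN⟩ := Set.ncard_eq_two.1 hd
    obtain ⟨f, hf⟩ := exists_embedding_of_iso e
    have hadj : G.Adj x y := hv (by rw [hN]; simp) (by rw [hN]; simp) hxy
    have hfv : ∀ w, f w ≠ v := fun w => by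
      have : f w ∈ ({v}ᶜ : Set _) := hf ▸ Set.mem_range_self w
      exact this
    -- in both cases the trace of a block of `G` is a block of `H`
    have hblock : ∀ s, G.IsBlockSet s → H.IsBlockSet (f ⁻¹' s) ∧
        ((H.induce (f ⁻¹' s)).IsTwoTree → (G.induce s).IsTwoTree) := by
      intro s hs
      by_cases hvs : v ∈ s
      · obtain ⟨-, -, h1, h2⟩ := isBlockSet_of_degree_two f hf hadj hN hs hvs
        exact ⟨h1, fun h => .step _ _ h h2⟩
      · obtain ⟨i⟩ := nonempty_iso_induce_preimage f hf hvs
        exact ⟨isBlockSet_preimage f hf hs hvs, fun h => h.of_iso i⟩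
    refine ⟨fun s hs => ?_, fun s s' hs hs' hn hn' => ?_⟩
    · by_cases hvs : v ∈ s
      · obtain ⟨hxs, hys, h1, h2⟩ := isBlockSet_of_degree_two f hf hadj hN hs hvs
        rcases ih.1 _ h1 with h | h | h
        · exact Or.inl (.step _ _ h h2)
        · -- the trace has at least two vertices
          obtain ⟨i⟩ := h
          have hvx : x ≠ v := by
            have : G.Adj v x := by rw [← mem_neighborSet, hN]; simp
            exact this.ne'
          have hvy : y ≠ v := by
            have : G.Adj v y := by rw [← mem_neighborSet, hN]; simp
            exact this.ne'
          obtain ⟨a, rfl⟩ : x ∈ Set.range f := hf ▸ hvx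
          obtain ⟨b, rfl⟩ : y ∈ Set.range f := hf ▸ hvy
          have := i.injective (a₁ := ⟨a, hxs⟩) (a₂ := ⟨b, hys⟩) (Subsingleton.elim _ _)
          exact absurd (congrArg f (congrArg Subtype.val this)) hxy
        · exact Or.inr (Or.inr (.step _ _ h h2))
      · obtain ⟨i⟩ := nonempty_iso_induce_preimage f hf hvs
        exact (ih.1 _ (isBlockSet_preimage f hf hs hvs)).imp (fun h => h.of_iso i)
          (Or.imp (fun h => h.map fun j => i.symm.trans j) (fun h => h.of_iso i))
    · have heq := ih.2 _ _ (hblock s hs).1 (hblock s' hs').1 (fun h => hn ((hblock s hs).2 h))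
        (fun h => hn' ((hblock s' hs').2 h))
      -- the two blocks agree up to `v`, so one contains the other
      have hsub : ∀ t t' : Set _, f ⁻¹' t = f ⁻¹' t' → (v ∈ t → v ∈ t') → t ⊆ t' := by
        intro t t' h hvt z hz
        by_cases hzv : z = v
        · subst hzv; exact hvt hz
        · obtain ⟨w, rfl⟩ : z ∈ Set.range f := hf ▸ hzv
          have : w ∈ f ⁻¹' t := hz
          rw [h] at this
          exact this
      by_cases hvs : v ∈ s'
      · have := hsub s s' heq (fun _ => hvs)
        exact Set.Subset.antisymm this (hs.2 hs'.1 this)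
      · have := hsub s' s heq.symm (fun h => absurd h hvs)
        exact (Set.Subset.antisymm this (hs'.2 hs.1 this)).symm

end ConstructibleBlocks

/-! ### Gluing the blocks together -/

section Glue

/-- The vertex set `t` arises from `s` by adding one vertex, whose neighbors in `s` form a clique
with `d` vertices. -/
def AttachStep {V : Type u} (G : SimpleGraph V) (d : ℕ) (s t : Set V) : Prop :=
  ∃ v ∉ s, t = insert v s ∧ G.IsClique (s ∩ G.neighborSet v) ∧ (s ∩ G.neighborSet v).ncard = d

theorem AttachStep.isSimplicialExtension {V : Type u} {G : SimpleGraph V} {d : ℕ} {s t : Set V}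
    (h : G.AttachStep d s t) : IsSimplicialExtension d (G.induce s) (G.induce t) := by
  obtain ⟨v, hv, rfl, hcl, hd⟩ := h
  have : insert v s ∩ G.neighborSet v = s ∩ G.neighborSet v :=
    Set.insert_inter_of_notMem (by simp)
  refine isSimplicialExtension_induce (Embedding.induce s) (Set.mem_insert v s) ?_ ?_ ?_
  · rw [Set.insert_sdiff_self_of_notMem hv, range_embedding_induce]
  · rwa [this]
  · rwa [this]

/-- Steps in a copy of `H` remain steps in the presence of further vertices `U`, if the vertices
still to be added have no neighbors in `U` outside the part already built. -/
theorem reflTransGen_attachStep_union {V : Type u} {W : Type v} {G : SimpleGraph V}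
    {H : SimpleGraph W} (f : H ↪g G) {d : ℕ} {s t : Set W}
    (h : Relation.ReflTransGen (H.AttachStep d) s t) {U : Set V}
    (hU : ∀ y ∉ s, f y ∉ U ∧ ∀ x ∈ U, G.Adj x (f y) → x ∈ f '' s) :
    Relation.ReflTransGen (G.AttachStep d) (U ∪ f '' s) (U ∪ f '' t) := by
  suffices s ⊆ t ∧ Relation.ReflTransGen (G.AttachStep d) (U ∪ f '' s) (U ∪ f '' t) from this.2
  induction h with
  | refl => exact ⟨subset_rfl, .refl⟩
  | @tail b c _ hbc ih =>
    obtain ⟨hsb, ih⟩ := ih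
    obtain ⟨v, hv, rfl, hcl, hd⟩ := hbc
    obtain ⟨hvU, hvN⟩ := hU v (fun h => hv (hsb h))
    have hN : (U ∪ f '' b) ∩ G.neighborSet (f v) = f '' (b ∩ H.neighborSet v) := by
      ext x
      constructor
      · rintro ⟨hx | ⟨y, hy, rfl⟩, hxv⟩
        · obtain ⟨y, hy, rfl⟩ := hvN x hx (show G.Adj (f v) x from hxv).symm
          exact ⟨y, ⟨hsb hy, f.map_adj_iff.1 hxv⟩, rfl⟩
        · exact ⟨y, ⟨hy, f.map_adj_iff.1 hxv⟩, rfl⟩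
      · rintro ⟨y, ⟨hy, hyv⟩, rfl⟩
        exact ⟨Or.inr ⟨y, hy, rfl⟩, f.map_adj_iff.2 hyv⟩
    refine ⟨hsb.trans (Set.subset_insert v b), ih.tail ⟨f v, ?_, ?_, ?_, ?_⟩⟩
    · rintro (h | ⟨y, hy, hyv⟩)
      · exact hvU h
      · exact hv (f.injective hyv ▸ hy)
    · rw [Set.image_insert_eq, Set.union_insert]
    · rw [hN]
      rintro _ ⟨x, hx, rfl⟩ _ ⟨y, hy, rfl⟩ hxy
      exact f.map_adj_iff.2 (hcl hx hy (fun h => hxy (by rw [h])))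
    · rw [hN, Set.ncard_image_of_injective _ f.injective, hd]

theorem attachStep_two_of_triangle {V : Type u} {G : SimpleGraph V} {x y z : V}
    (hxy : G.Adj x y) (hzx : G.Adj z x) (hzy : G.Adj z y) :
    G.AttachStep 2 {x, y} {z, x, y} := by
  have hN : {x, y} ∩ G.neighborSet z = {x, y} := by
    rw [Set.inter_eq_left]
    rintro w (rfl | rfl) <;> assumption
  refine ⟨z, by simp [hzx.ne, hzy.ne], rfl, ?_, ?_⟩ <;> rw [hN]
  · exact isClique_pair.2 fun _ => hxy
  · exact Set.ncard_pair hxy.ne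

/-- A 2-tree can be built up by simplicial vertices of degree 2 starting from any of its edges. -/
theorem IsTwoTree.reflTransGen_attachStep {V : Type u} {G : SimpleGraph V} (h : G.IsTwoTree) :
    ∀ x y, G.Adj x y → Relation.ReflTransGen (G.AttachStep 2) {x, y} Set.univ := by
  induction h with
  | base G h =>
    obtain ⟨e⟩ := h
    intro x y hxy
    have : ({x, y} : Set _) = Set.univ := by
      refine Set.eq_univ_of_forall fun z => ?_
      have hne : e x ≠ e y := e.injective.ne hxy.ne
      have : e z = e x ∨ e z = e y := by
        revert hne
        generalize e x = a
        generalize e y = b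
        generalize e z = c
        decide +revert
      simpa [e.injective.eq_iff] using this
    rw [this]
  | step H G _ h ih =>
    obtain ⟨v, hv, hd, ⟨e⟩⟩ := h
    obtain ⟨p, q, hpq, hN⟩ := Set.ncard_eq_two.1 hd
    obtain ⟨f, hf⟩ := exists_embedding_of_iso e
    have hadj : G.Adj p q := hv (by rw [hN]; simp) (by rw [hN]; simp) hpq
    have hvadj : ∀ z, G.Adj v z ↔ z = p ∨ z = q := by
      intro z
      rw [← mem_neighborSet, hN]
      simp
    have hvp := (hvadj p).2 (Or.inl rfl)
    have hvq := (hvadj q).2 (Or.inr rfl)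
    have hfv : ∀ w, f w ≠ v := fun w => by
      have : f w ∈ ({v}ᶜ : Set _) := hf ▸ Set.mem_range_self w
      exact this
    obtain ⟨a, rfl⟩ : p ∈ Set.range f := hf ▸ hvp.ne'
    obtain ⟨b, rfl⟩ : q ∈ Set.range f := hf ▸ hvq.ne'
    have hab : H.Adj a b := f.map_adj_iff.1 hadj
    have huniv : insert v (Set.range f) = Set.univ := by
      rw [hf]
      exact Set.eq_univ_of_forall fun z => by simp [em]
    -- with `v` present from the start, the steps building up `H` from `a b` are still available
    have hfrom : Relation.ReflTransGen (G.AttachStep 2) {v, f a, f b} Set.univ := by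
      have := reflTransGen_attachStep_union f (ih a b hab) (U := {v}) (by
        refine fun y hy => ⟨hfv y, ?_⟩
        rintro _ rfl hvy
        refine absurd ?_ hy
        simpa [f.injective.eq_iff] using (hvadj _).1 hvy)
      rwa [Set.image_univ, Set.image_pair, Set.singleton_union, Set.singleton_union, huniv] at this
    have hstart : ∀ y, G.Adj v y → Relation.ReflTransGen (G.AttachStep 2) {v, y} Set.univ := by
      intro y hy
      rcases (hvadj y).1 hy with rfl | rfl
      · refine .head ?_ hfrom
        have := attachStep_two_of_triangle hvp hvq.symm hadj.symm
        rwa [Set.insert_comm, Set.pair_comm (f b)] at this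
      · refine .head ?_ hfrom
        have := attachStep_two_of_triangle hvq hvp.symm hadj
        rwa [Set.insert_comm] at this
    intro x y hxy
    by_cases hx : x = v
    · subst hx
      exact hstart y hxy
    by_cases hy : y = v
    · subst hy
      rw [Set.pair_comm]
      exact hstart x hxy.symm
    obtain ⟨x, rfl⟩ : x ∈ Set.range f := hf ▸ hx
    obtain ⟨y, rfl⟩ : y ∈ Set.range f := hf ▸ hy
    have := reflTransGen_attachStep_union f (ih x y (f.map_adj_iff.1 hxy)) (U := ∅) (by simp)
    rw [Set.image_univ, Set.image_pair, Set.empty_union, Set.empty_union] at this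
    refine this.tail ⟨v, by rw [hf]; simp, huniv.symm, ?_, ?_⟩
    · exact IsClique.subset Set.inter_subset_right hv
    · rw [Set.inter_eq_right.2, hd]
      intro z hz
      rw [hf]
      exact (show G.Adj v z from hz).ne'

theorem isSimpliciallyConstructible_of_reflTransGen {V : Type u} {G : SimpleGraph V}
    {s t : Set V} (h : Relation.ReflTransGen (G.AttachStep 2) s t)
    (hs : (G.induce s).IsSimpliciallyConstructible) :
    (G.induce t).IsSimpliciallyConstructible := by
  induction h with
  | refl => exact hs
  | tail _ hst ih => exact .attachTwo _ _ ih hst.isSimplicialExtension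

/-- Grow a constructible vertex set `U` by whole blocks. Throughout, `U` is gated: a connected set
outside `U` has neighbors in at most one vertex of `U`. So a further block meeting `U` does so in a
single vertex, and is a 2-tree, built up from an edge at that vertex. -/
theorem HasTwoTreeBlocks.isSimpliciallyConstructible {V : Type u} [Finite V] {G : SimpleGraph V}
    (h : G.HasTwoTreeBlocks) (hG : G.Connected) : G.IsSimpliciallyConstructible := by
  let Gated : Set V → Prop := fun U => ∀ K, G.ConnOn K → (∀ x ∈ K, x ∉ U) → ∀ p ∈ U, ∀ q ∈ U,
    (∃ x ∈ K, G.Adj p x) → (∃ x ∈ K, G.Adj q x) → p = q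
  let Good : Set V → Prop := fun U => U.Nonempty ∧ (G.induce U).IsSimpliciallyConstructible ∧
    Gated U ∧ ∀ B, G.IsBlockSet B → ¬ (G.induce B).IsTwoTree → B ⊆ U
  have hgate : ∀ B, G.IsBlockSet B → Gated B := fun B hB K hK hKB p hp q hq h1 h2 =>
    hB.eq_of_adj hK hKB hp hq h1 h2
  have hstart : ∃ U, Good U := by
    by_cases hall : ∀ B, G.IsBlockSet B → (G.induce B).IsTwoTree
    · obtain ⟨r⟩ := hG.nonempty
      refine ⟨{r}, ⟨r, rfl⟩, .kOne _ ⟨?_⟩, ?_, fun B hB hn => absurd (hall B hB) hn⟩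
      · exact ⟨Equiv.ofUnique _ (Fin 1), by
          intro a b
          simp [Subsingleton.elim a b]⟩
      · rintro K - - p rfl q rfl - -
        rfl
    · push Not at hall
      obtain ⟨B, hB, hn⟩ := hall
      refine ⟨B, hB.1.1, ?_, hgate B hB, fun B' hB' hn' => (h.2 _ _ hB' hB hn' hn).subset⟩
      rcases h.1 B hB with h' | h' | h'
      · exact absurd h' hn
      · exact .kOne _ h'
      · exact h'.isSimpliciallyConstructible
  obtain ⟨U₀, hU₀⟩ := hstart
  obtain ⟨U, -, ⟨⟨r, hr⟩, hU, hgU, hspec⟩, hmax⟩ :=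
    (Set.toFinite {U | Good U}).exists_le_maximal hU₀
  have huniv : U = Set.univ := by
    by_contra hne
    obtain ⟨w₀, hw₀⟩ := (Set.ne_univ_iff_exists_notMem U).1 hne
    obtain ⟨u, -, huU, w, -, hwU, huw⟩ := (connOn_univ_iff.2 hG.preconnected).exists_adj
      (Set.mem_univ r) hr (Set.mem_univ w₀) hw₀
    obtain ⟨B, huwB, hB⟩ := (isBiconnOn_pair huw).exists_isBlockSet
    have huB : u ∈ B := huwB (by simp)
    have hwB : w ∈ B := huwB (by simp)
    have hwu : w ∈ B \ {u} := ⟨hwB, huw.ne'⟩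
    have hBu : G.ConnOn (B \ {u}) := hB.1.2.2 u
    have hBtt : (G.induce B).IsTwoTree := by
      by_contra hn
      exact hwU (hspec B hB hn hwB)
    -- the block meets `U` in `u` only
    have hBU : ∀ x ∈ B \ {u}, x ∉ U := by
      intro x hx hxU
      have hwS : w ∈ (B \ {u}) \ U := ⟨hwu, hwU⟩
      have hsub := compOn_subset (G := G) hwS
      obtain ⟨a, haB, ha, b, hbB, hb, hab⟩ := hBu.exists_adj (T := G.compOn ((B \ {u}) \ U) w)
        hwu (mem_compOn _ _) hx (fun h => (hsub h).2 hxU)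
      have hbU : b ∈ U := by
        by_contra hbU
        exact hb (compOn_closed ha ⟨hbB, hbU⟩ hab)
      exact hbB.2 (hgU _ (connOn_compOn hwS) (fun z hz => (hsub hz).2) b hbU u huU
        ⟨a, ha, hab.symm⟩ ⟨w, mem_compOn _ _, huw⟩)
    have hnadj : ∀ x ∈ U, x ≠ u → ∀ y ∈ B \ {u}, ¬ G.Adj x y := fun x hx hxu y hy hxy =>
      hxu (hgU _ hBu hBU x hx u huU ⟨y, hy, hxy⟩ ⟨w, hwu, huw⟩)
    refine hwU (hmax (y := U ∪ B) ⟨⟨u, Or.inl huU⟩, ?_, ?_, fun B' hB' hn =>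
      (hspec B' hB' hn).trans Set.subset_union_left⟩ Set.subset_union_left (Or.inr hwB))
    · let f : G.induce B ↪g G := Embedding.induce B
      have hchain := reflTransGen_attachStep_union f (U := U)
        (hBtt.reflTransGen_attachStep ⟨u, huB⟩ ⟨w, hwB⟩ huw) (by
          intro y hy
          have hyu : (y : V) ∈ B \ {u} := ⟨y.2, fun h => hy (Or.inl (Subtype.ext h))⟩
          refine ⟨hBU y hyu, fun x hx hxy => ⟨⟨u, huB⟩, Or.inl rfl, ?_⟩⟩
          by_contra hux
          exact hnadj x hx (fun h => hux h.symm) y hyu hxy)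
      have hfB : f '' Set.univ = B := Set.image_univ.trans (range_embedding_induce B)
      have hfu : U ∪ f '' {⟨u, huB⟩, ⟨w, hwB⟩} = insert w U := by
        rw [Set.image_pair]
        ext z
        simp only [f, Embedding.induce, Set.mem_union, Set.mem_insert_iff, Set.mem_singleton_iff]
        constructor
        · rintro (h | h | h)
          exacts [Or.inr h, Or.inr (h ▸ huU), Or.inl h]
        · rintro (h | h)
          exacts [Or.inr (Or.inr h), Or.inl h]
      rw [hfB, hfu] at hchain
      have hNw : U ∩ G.neighborSet w = {u} := by
        ext z
        constructor
        · rintro ⟨hz, hwz⟩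
          by_contra hzu
          exact hnadj z hz hzu w hwu (show G.Adj w z from hwz).symm
        · rintro rfl
          exact ⟨huU, huw.symm⟩
      have hone : G.AttachStep 1 U (insert w U) :=
        ⟨w, hwU, rfl, by rw [hNw]; simp, by rw [hNw]; simp⟩
      have hc := IsSimpliciallyConstructible.attachOne _ _ hU hone.isSimplicialExtension
      exact isSimpliciallyConstructible_of_reflTransGen hchain hc
    · -- a set outside attached to both `U` and `B` extends by `B \ {u}` to a set outside `U`
      intro K hK hKUB
      have hmix : ∀ p ∈ U, ∀ q ∈ B, (∃ x ∈ K, G.Adj p x) → (∃ x ∈ K, G.Adj q x) → p = q := by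
        rintro p hp q hq ⟨x, hx, hpx⟩ ⟨y, hy, hqy⟩
        by_cases hqu : q = u
        · subst hqu
          exact hgU K hK (fun z hz h => hKUB z hz (Or.inl h)) p hp q huU ⟨x, hx, hpx⟩ ⟨y, hy, hqy⟩
        · have hpu : p = u := hgU (K ∪ B \ {u})
            (hK.union_of_adj hBu hy ⟨hq, hqu⟩ hqy.symm) (by
              rintro z (hz | hz) hzU
              exacts [hKUB z hz (Or.inl hzU), hBU z hz hzU]) p hp u huU
            ⟨x, Or.inl hx, hpx⟩ ⟨w, Or.inr hwu, huw⟩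
          subst hpu
          exact hgate B hB K hK (fun z hz h => hKUB z hz (Or.inr h)) p huB q hq ⟨x, hx, hpx⟩
            ⟨y, hy, hqy⟩
      rintro p (hp | hp) q (hq | hq) h1 h2
      · exact hgU K hK (fun z hz h => hKUB z hz (Or.inl h)) p hp q hq h1 h2
      · exact hmix p hp q hq h1 h2
      · exact (hmix q hq p hp h2 h1).symm
      · exact hgate B hB K hK (fun z hz h => hKUB z hz (Or.inr h)) p hp q hq h1 h2
  rw [huniv] at hU
  exact hU.of_iso (induceUnivIso G)

end Glue

end SimpleGraph

theorem mainTheorem1 {V : Type u} [Finite V] (G : SimpleGraph V) (hconn : G.Connected)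
    (hK4 : ¬ (SimpleGraph.completeGraph (Fin 4)).IsMinor G) :
    List.TFAE [
      G.IsOnePerfectlyOrientable,
      ¬ (completeBipartiteGraph (Fin 2) (Fin 3)).IsInducedMinor G ∧
        ¬ SimpleGraph.graphF1.IsInducedMinor G ∧ ¬ SimpleGraph.graphF2.IsInducedMinor G,
      (∀ B : G.Subgraph, G.IsBlock B →
          B.coe.IsTwoTree ∨ B.coe.IsKOne ∨ B.coe.IsHollowedTwoTree) ∧
        ∀ B B' : G.Subgraph, G.IsBlock B → G.IsBlock B' →
          ¬ B.coe.IsTwoTree → ¬ B'.coe.IsTwoTree → B = B',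
      G.IsSimpliciallyConstructible] := by
  rw [← SimpleGraph.hasTwoTreeBlocks_iff]
  tfae_have 1 → 2 := fun h => h.not_isInducedMinor
  tfae_have 2 → 4 := fun ⟨h1, h2, h3⟩ =>
    SimpleGraph.isSimpliciallyConstructible_of_not_isInducedMinor G hconn hK4 h1 h2 h3
  tfae_have 4 → 1 := fun h => h.isOnePerfectlyOrientable
  tfae_have 4 → 3 := fun h => h.hasTwoTreeBlocks
  tfae_have 3 → 4 := fun h => h.isSimpliciallyConstructible hconn
  tfae_finish
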